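/- Notation. For $n\in\mathbb{N}_0$ let $V(n)$ be the space of complex homogeneous polynomials of degree $n$ in $x,y$, and $V_{\mathbb R}(n)\subset V(n)$ the real vector space of those with real coefficients. Roots of $p\in V(n)$ are points $(x:y)$ of the Riemann sphere $\mathbb{CP}^1=\mathbb{C}\cup\{\infty\}$, where $z\in\mathbb{C}$ is $(z:1)$ and $\infty=(1:0)$. For $S\subseteq\mathbb{CP}^1$, $p$ is $S$-rooted if all its roots lie in $S$, and real-rooted if it is $(\mathbb{R}\cup\{\infty\})$-rooted; the zero polynomial vanishes everywhere, so it is not $S$-rooted when $S\ne\mathbb{CP}^1$. Let $\mathcal{H}_+,\mathcal{H}_-\subset\mathbb{C}$ be the open upper and lower half-planes, with closures $\overline{\mathcal{H}_\pm}$ taken in $\mathbb{CP}^1$. A form $p\in V(m)$ is top-degree monic if its coefficient of $x^m$ is $1$. For $p,q\in V_{\mathbb R}(m)$ write $p\ll q$ if $q+ip$ is zero or has no root in $\mathcal{H}_+$. A linear map $T:V(n)\to V(m)$ preserves weak real-rootedness if $T(p)$ is real-rooted or zero for every real-rooted $p\in V_{\mathbb R}(n)$. Its symbol is $$\operatorname{Symb}(T)(z:w,x:y)=T\big[(zy-xw)^n\big]=\sum_{k=0}^n\binom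 nk z^{n-k}(-w)^k\,T(x^ky^{n-k}),$$ and it is $(A\times B)$-stable if it does not vanish for $(z:w)\in A$, $(x:y)\in B$. Theorem. Let $n,m\in\mathbb{N}_0$ and let $T:V(n)\to V(m)$ be a linear map with $T(V_{\mathbb R}(n))\subseteq V_{\mathbb R}(m)$. Let $I\subseteq\mathbb{R}$ be any nonempty interval and let $J$ be one of $(a,b)$, $[a,b)$, $(a,b]$ with real $a<b$. The following are equivalent. (i) $T$ preserves weak real-rootedness, and $T(p)$ is nonzero and $J$-rooted for every $I$-rooted $p\in V(n)$. (ii) One of the following holds: (a) $\operatorname{Symb}(T)$ is $\big((\mathcal{H}_-\cup I)\times(\overline{\mathcal{H}_+}\setminus J)\big)$-stable. (b) $\operatorname{Symb}(T)$ is $\big((\mathcal{H}_-\cup I)\times(\overline{\mathcal{H}_-}\setminus J)\big)$-stable. (c) The image of $T$ has dimension at most two, and there are top-degree monic $p_1,p_2\in V_{\mathbb R}(m)$ with $p_1\ll p_2$ and real linear functionals $\psi_1,\psi_2:V_{\mathbb R}(n)\to\mathbb{R}$ such that $T(p)=\psi_1(p)\,p_1+\psi_2(p)\,p_2$ for all $p\in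 V_{\mathbb R}(n)$ and such that, for every $I$-rooted $p\in V_{\mathbb R}(n)$, $\psi_1(p)\psi_2(p)\ge 0$ and $\psi_1(p),\psi_2(p)$ are not both zero. Moreover: - if the image of $T$ has dimension less than two, then $p_1$ and $p_2$ are $J$-rooted; - if the image of $T$ has dimension exactly two, then $p_1$ and $p_2$ are $\overline J$-rooted (with $\overline J=[a,b]$); if $m\ge 2$, then the largest root of $p_1$ and the smallest root of $p_2$ lie in $J$; if $p_2$ is not $J$-rooted, then $\psi_1(p)\neq0$ for every $I$-rooted $p\in V_{\mathbb R}(n)$; and if $p_1$ is not $J$-rooted, then $\psi_2(p)\ne0$ for every $I$-rooted $p\in V_{\mathbb R}(n)$. -/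

import Mathlib

/-! Binary forms, their roots on the Riemann sphere, and the universal symbol of a linear operator. -/

namespace BinaryForm

/-- `V n`: complex forms of degree `n` in two variables; `X 0` plays the role of `x` and `X 1` the
role of `y`. -/
abbrev V (n : ℕ) : Submodule ℂ (MvPolynomial (Fin 2) ℂ) :=
  MvPolynomial.homogeneousSubmodule (Fin 2) ℂ n

/-- `VR n`: the forms in `V n` all of whose coefficients are real, a real vector space. -/
def VR (n : ℕ) : Submodule ℝ (V n) where
  carrier := {p | ∀ d, (MvPolynomial.coeff d (p : MvPolynomial (Fin 2) ℂ)).im = 0}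
  zero_mem' := by intro d; simp
  add_mem' := by
    intro p q hp hq d
    simp [hp d, hq d]
  smul_mem' := by
    intro c p hp d
    have h : ((c • p : V n) : MvPolynomial (Fin 2) ℂ)
        = (c : ℂ) • (p : MvPolynomial (Fin 2) ℂ) := by
      ext e
      simp
    rw [h]
    simp [hp d]

/-- The monomial `x ^ k * y ^ (n - k)` for `k ≤ n`. -/
noncomputable def mono (n : ℕ) (k : Fin (n + 1)) : V n :=
  ⟨MvPolynomial.X 0 ^ (k : ℕ) * MvPolynomial.X 1 ^ (n - (k : ℕ)), by
    rw [MvPolynomial.mem_homogeneousSubmodule]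
    have h := (MvPolynomial.isHomogeneous_X_pow (R := ℂ) (0 : Fin 2) (k : ℕ)).mul
      (MvPolynomial.isHomogeneous_X_pow (R := ℂ) (1 : Fin 2) (n - (k : ℕ)))
    have hk : (k : ℕ) + (n - (k : ℕ)) = n := by have := k.isLt; omega
    rwa [hk] at h⟩

/-- Homogeneous coordinates on the Riemann sphere `ℂ ∪ {∞}`: `z` is `(z : 1)` and `∞` is
`(-1 : 0) = (1 : 0)`. -/
noncomputable def coords (P : OnePoint ℂ) : Fin 2 → ℂ :=
  P.elim ![1, 0] (fun z => ![z, 1])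

/-- `P` is a root of the form `p`; for forms this does not depend on the choice of homogeneous
coordinates of `P`. -/
def IsRoot {n : ℕ} (p : V n) (P : OnePoint ℂ) : Prop :=
  MvPolynomial.eval (coords P) (p : MvPolynomial (Fin 2) ℂ) = 0

/-- `p` has no root in `Ω`. -/
def IsStable {n : ℕ} (Ω : Set (OnePoint ℂ)) (p : V n) : Prop :=
  ∀ P ∈ Ω, ¬ IsRoot p P

/-- The open upper half-plane in the Riemann sphere. -/
def upperH : Set (OnePoint ℂ) := (fun z : ℂ => (z : OnePoint ℂ)) '' {z | 0 < z.im}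

/-- The open lower half-plane in the Riemann sphere. -/
def lowerH : Set (OnePoint ℂ) := (fun z : ℂ => (z : OnePoint ℂ)) '' {z | z.im < 0}

/-- A set of real numbers as a subset of the Riemann sphere. -/
def realSet (S : Set ℝ) : Set (OnePoint ℂ) := (fun t : ℝ => ((t : ℂ) : OnePoint ℂ)) '' S

/-- All roots of `p` on the Riemann sphere lie in `S`. The zero form vanishes everywhere, so it is
`S`-rooted only if `S` is the whole sphere. -/
def IsRootedIn {n : ℕ} (S : Set (OnePoint ℂ)) (p : V n) : Prop :=
  ∀ P, IsRoot p P → P ∈ S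

/-- All roots of `p` lie in `ℝ ∪ {∞}`. -/
def IsRealRooted {n : ℕ} (p : V n) : Prop :=
  IsRootedIn (closure (realSet Set.univ)) p

/-- The coefficient of `x ^ n` is `1`. -/
def IsTopMonic {n : ℕ} (p : V n) : Prop :=
  MvPolynomial.coeff (Finsupp.single 0 n) (p : MvPolynomial (Fin 2) ℂ) = 1

/-- The finite real roots of `p`. -/
def realRoots {n : ℕ} (p : V n) : Set ℝ := {t | IsRoot p ((t : ℂ) : OnePoint ℂ)}

/-- Proper position `p ≪ q` of two real forms: `q + i p` is zero or has no root in the open upper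
half-plane. -/
def ProperPosition {n : ℕ} (p q : V n) : Prop :=
  q + Complex.I • p = 0 ∨ IsStable upperH (q + Complex.I • p)

/-- The universal symbol
`∑ k, (n choose k) * z ^ (n - k) * (-w) ^ k * T (x ^ k * y ^ (n - k)) = T [(z y - x w) ^ n]`,
where `z, w` are the variables `inl 0, inl 1` and `x, y` are the variables `inr 0, inr 1`. -/
noncomputable def symb {n m : ℕ} (T : V n →ₗ[ℂ] V m) : MvPolynomial (Fin 2 ⊕ Fin 2) ℂ :=
  ∑ k : Fin (n + 1),
    (MvPolynomial.C ((n.choose k : ℕ) : ℂ)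
      * MvPolynomial.X (Sum.inl 0) ^ (n - (k : ℕ)) * (-MvPolynomial.X (Sum.inl 1)) ^ (k : ℕ))
      * MvPolynomial.rename Sum.inr ((T (mono n k) : V m) : MvPolynomial (Fin 2) ℂ)

/-- `F (z : w, x : y)` does not vanish for `(z : w) ∈ A` and `(x : y) ∈ B`. -/
def IsStableOn (A B : Set (OnePoint ℂ)) (F : MvPolynomial (Fin 2 ⊕ Fin 2) ℂ) : Prop :=
  ∀ P ∈ A, ∀ Q ∈ B, MvPolynomial.eval (Sum.elim (coords P) (coords Q)) F ≠ 0

/-- `T` maps real forms to real forms. -/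
def IsRealOperator {n m : ℕ} (T : V n →ₗ[ℂ] V m) : Prop :=
  ∀ p ∈ VR n, T p ∈ VR m

/-- `T` maps every real-rooted real form to a real-rooted form or to zero. -/
def PreservesWeakRealRootedness {n m : ℕ} (T : V n →ₗ[ℂ] V m) : Prop :=
  ∀ p ∈ VR n, IsRealRooted p → T p = 0 ∨ IsRealRooted (T p)

/-- The dimension of the image of `T`. -/
noncomputable def imageDim {n m : ℕ} (T : V n →ₗ[ℂ] V m) : ℕ :=
  Module.finrank ℂ (LinearMap.range T)

/-- The degenerate condition for an interval `J` that need not be closed. The first alternative at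
the end is for image dimension at most one, the second for image dimension exactly two. -/
def IsDegenerate {n m : ℕ} (T : V n →ₗ[ℂ] V m) (I J : Set ℝ) : Prop :=
  imageDim T ≤ 2 ∧
  ∃ (p₁ p₂ : V m) (ψ₁ ψ₂ : VR n →ₗ[ℝ] ℝ),
    p₁ ∈ VR m ∧ p₂ ∈ VR m ∧ IsTopMonic p₁ ∧ IsTopMonic p₂ ∧ ProperPosition p₁ p₂ ∧
    (∀ p : VR n, T (p : V n) = ψ₁ p • p₁ + ψ₂ p • p₂) ∧
    (∀ p : VR n, IsRootedIn (realSet I) (p : V n) →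
      0 ≤ ψ₁ p * ψ₂ p ∧ (ψ₁ p ≠ 0 ∨ ψ₂ p ≠ 0)) ∧
    (imageDim T ≠ 2 → IsRootedIn (realSet J) p₁ ∧ IsRootedIn (realSet J) p₂) ∧
    (imageDim T = 2 →
      IsRootedIn (realSet (closure J)) p₁ ∧ IsRootedIn (realSet (closure J)) p₂ ∧
      (2 ≤ m →
        (∃ t ∈ J, IsGreatest (realRoots p₁) t) ∧ (∃ t ∈ J, IsLeast (realRoots p₂) t)) ∧
      (¬ IsRootedIn (realSet J) p₂ →
        ∀ p : VR n, IsRootedIn (realSet I) (p : V n) → ψ₁ p ≠ 0) ∧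
      (¬ IsRootedIn (realSet J) p₁ →
        ∀ p : VR n, IsRootedIn (realSet I) (p : V n) → ψ₂ p ≠ 0))

end BinaryForm

namespace BinaryForm

open Polynomial Filter Topology ComplexConjugate

/-! ### Real and imaginary parts: Hermite–Biehler, the pairing `Im (F * conj G)`, and Hurwitz. -/

section


/-! Setting `y = 1` turns forms into polynomials of bounded degree; a root at `∞` becomes a
vanishing top coefficient. The operator becomes a real map `A` with complexification `B`, and the
symbol at `(z, Q)` is the value of `B ((z - X) ^ n)` at `Q`.

A stable symbol gives the mapping properties by Grace–Walsh (`grace_lowerUnion`): a functional that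
is nonzero on `(z - X) ^ n` for all `z` in the lower half-plane together with `I` is nonzero on
products of `n` such factors with different `z`. With "evaluate `B` at `Q`" as the functional,
images of `I`-rooted polynomials have no root in one closed half-plane off `J`, and conjugation
handles the other. For real-rooted polynomials, the roots are first pushed into the lower
half-plane; Hurwitz handles the limit.

Conversely, for `z` below the axis all real combinations of the real and imaginary parts of `(z - X)
^ n` are real-rooted (Hermite–Biehler), hence so are those of their images `F`, `G`. If the pairing
`Im (F * conj G)` at `i` never vanishes, it has constant sign in `z`, and the symbol is stable in
the upper or the lower half-plane (`stable_or_stable_or_splits`); Hurwitz in the variable `z`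
extends this to the boundary off `J`. If it vanishes for some `z`, then `A` kills a nonzero real
combination of the two parts. A large multiple of that combination makes any polynomial real-rooted
without changing its image, up to scale, so every value of `A` is real-rooted.

In that case the image is at most a plane, since a nonzero real-rooted polynomial cannot vanish at
`i`. A plane is spanned by a monic `u` and some `v` of lower degree, and the roots of `u + t v` are
monotone in `t`. The infimum and supremum of the parameters of `J`-rooted members give `p₁` and
`p₂`; they differ because `J` lacks an endpoint. The functionals `ψ₁`, `ψ₂` are the coordinates with
respect to `p₁`, `p₂`. For the return direction, outside `J` the values of `p₁` and `p₂` have weakly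
equal sign, so a combination with `ψ₁ ψ₂ ≥ 0` cannot cancel there. -/

/-- The inclusion of real polynomials into complex polynomials. -/
noncomputable abbrev toC (P : ℝ[X]) : ℂ[X] := P.map (algebraMap ℝ ℂ)

lemma coeff_sum_monomial_re (P : ℂ[X]) (k : ℕ) :
    (∑ j ∈ P.support, monomial j (P.coeff j).re).coeff k = (P.coeff k).re := by
  simp +contextual [finsetSum_coeff, coeff_monomial]

/-- The polynomial of the real parts of the coefficients. -/
noncomputable def rePart : ℂ[X] →ₗ[ℝ] ℝ[X] where
  toFun P := ∑ k ∈ P.support, monomial k (P.coeff k).re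
  map_add' P Q := by
    ext k
    rw [coeff_add, coeff_sum_monomial_re, coeff_sum_monomial_re, coeff_sum_monomial_re, coeff_add,
      Complex.add_re]
  map_smul' c P := by
    ext k
    rw [RingHom.id_apply, coeff_smul, coeff_sum_monomial_re, coeff_sum_monomial_re, coeff_smul]
    simp

@[simp] lemma coeff_rePart (P : ℂ[X]) (k : ℕ) : (rePart P).coeff k = (P.coeff k).re :=
  coeff_sum_monomial_re P k

/-- The polynomial of the imaginary parts of the coefficients. -/
noncomputable def imPart (P : ℂ[X]) : ℝ[X] := rePart (C (-Complex.I) * P)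

@[simp] lemma coeff_imPart (P : ℂ[X]) (k : ℕ) : (imPart P).coeff k = (P.coeff k).im := by
  simp only [imPart, coeff_rePart, coeff_C_mul]; simp

lemma rePart_add_imPart (P : ℂ[X]) : toC (rePart P) + C Complex.I * toC (imPart P) = P := by
  ext k
  simp only [coeff_add, coeff_map, coeff_C_mul, coeff_rePart, coeff_imPart]
  rw [mul_comm]; exact Complex.re_add_im _

lemma rePart_toC (P : ℝ[X]) : rePart (toC P) = P := by ext k; simp

lemma natDegree_rePart_le (P : ℂ[X]) : (rePart P).natDegree ≤ P.natDegree :=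
  natDegree_le_iff_coeff_eq_zero.2 fun k hk => by simp [coeff_eq_zero_of_natDegree_lt hk]

lemma toC_injective : Function.Injective toC := map_injective _ (algebraMap ℝ ℂ).injective

lemma eval_toC_conj (P : ℝ[X]) (z : ℂ) : (toC P).eval (conj z) = conj ((toC P).eval z) := by
  rw [eval_map, eval_map, hom_eval₂]
  congr 1
  ext x; simp

lemma eval_toC_ofReal (P : ℝ[X]) (x : ℝ) : (toC P).eval (x : ℂ) = (P.eval x : ℝ) := by
  rw [eval_map]; exact eval₂_at_apply (algebraMap ℝ ℂ) x

/-- The value of the real part in terms of the values of the polynomial. -/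
lemma two_mul_eval_rePart (P : ℂ[X]) (z : ℂ) :
    2 * (toC (rePart P)).eval z = P.eval z + conj (P.eval (conj z)) := by
  conv_rhs => rw [← rePart_add_imPart P]
  simp only [eval_add, eval_mul, eval_C, map_add, map_mul, eval_toC_conj, Complex.conj_I,
    Complex.conj_conj]
  ring

/-- Roots of a real polynomial come in conjugate pairs, so one half-plane suffices. -/
lemma splits_of_upper {P : ℝ[X]} (h : ∀ z : ℂ, 0 < z.im → (toC P).eval z ≠ 0) : P.Splits := by
  refine (IsAlgClosed.splits (toC P)).of_splits_map (i := algebraMap ℝ ℂ) ?_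
  intro z hz
  have hz' : (toC P).eval z = 0 := (mem_roots'.1 hz).2
  rcases lt_trichotomy z.im 0 with h0 | h0 | h0
  · exact absurd (by rw [eval_toC_conj, hz', map_zero]) (h (conj z) (by simpa using h0))
  · exact ⟨z.re, Complex.ext (by simp) (by simp [h0])⟩
  · exact absurd hz' (h z h0)

lemma eval_toC_ne_zero {P : ℝ[X]} (hP : P.Splits) (h0 : P ≠ 0) {z : ℂ} (hz : z.im ≠ 0) :
    (toC P).eval z ≠ 0 := by
  intro h
  obtain ⟨x, rfl⟩ := hP.mem_range_of_isRoot (i := algebraMap ℝ ℂ) h0 h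
  simp at hz

/-- A point strictly below the real axis is strictly nearer to `conj x` than to `x`; a real point is
equidistant. The comparison of the products is made factor by factor. -/
lemma norm_conj_sub_prod_lt (s : Multiset ℂ) (hs : ∀ r ∈ s, r.im ≤ 0) {x : ℂ} (hx : 0 < x.im) :
    (∀ r ∈ s, r.im = 0) ∨
      ‖(s.map (fun r => conj x - r)).prod‖ < ‖(s.map (fun r => x - r)).prod‖ := by
  have key : ∀ r : ℂ, r.im ≤ 0 → (r.im = 0 ∧ ‖conj x - r‖ = ‖x - r‖) ∨ ‖conj x - r‖ < ‖x - r‖ := by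
    intro r hr
    rcases hr.lt_or_eq with h | h
    · right
      rw [← sq_lt_sq₀ (norm_nonneg _) (norm_nonneg _), ← Complex.normSq_eq_norm_sq,
        ← Complex.normSq_eq_norm_sq, Complex.normSq_apply, Complex.normSq_apply]
      simp only [Complex.sub_re, Complex.sub_im, Complex.conj_re, Complex.conj_im]
      nlinarith
    · left
      refine ⟨h, ?_⟩
      rw [← sq_eq_sq₀ (norm_nonneg _) (norm_nonneg _), ← Complex.normSq_eq_norm_sq,
        ← Complex.normSq_eq_norm_sq, Complex.normSq_apply, Complex.normSq_apply]
      simp only [Complex.sub_re, Complex.sub_im, Complex.conj_re, Complex.conj_im, h]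
      ring
  induction s using Multiset.induction_on with
  | empty => left; simp
  | cons a s ih =>
    have hpos : 0 < ‖(s.map (fun r => x - r)).prod‖ := by
      rw [norm_pos_iff, ne_eq, Multiset.prod_eq_zero_iff]
      intro h
      obtain ⟨r, hr, h⟩ := Multiset.mem_map.1 h
      have := hs r (Multiset.mem_cons_of_mem hr)
      rw [← sub_eq_zero.1 h] at this
      linarith
    have hle : ‖(s.map (fun r => conj x - r)).prod‖ ≤ ‖(s.map (fun r => x - r)).prod‖ := by
      have e : ∀ f : ℂ → ℂ, ‖(s.map f).prod‖ = (s.map (fun r => ‖f r‖)).prod := fun f => by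
        simpa [Function.comp_def] using map_multiset_prod (normHom : ℂ →*₀ ℝ) (s.map f)
      rw [e, e]
      refine Multiset.prod_map_le_prod_map₀ _ _ (fun _ _ => norm_nonneg _) fun r hr => ?_
      rcases key r (hs r (Multiset.mem_cons_of_mem hr)) with h | h
      · exact h.2.le
      · exact h.le
    simp only [Multiset.map_cons, Multiset.prod_cons, norm_mul]
    rcases key a (hs a (Multiset.mem_cons_self a s)) with h | h
    · rcases ih fun r hr => hs r (Multiset.mem_cons_of_mem hr) with h' | h'
      · left
        intro r hr
        rcases Multiset.mem_cons.1 hr with rfl | hr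
        · exact h.1
        · exact h' r hr
      · right
        rw [h.2]
        refine mul_lt_mul_of_pos_left h' ?_
        rw [norm_pos_iff]
        intro h0
        have h1 := h.1
        rw [← sub_eq_zero.1 h0] at h1
        linarith
    · right
      exact (mul_le_mul_of_nonneg_left hle (norm_nonneg _)).trans_lt (mul_lt_mul_of_pos_right h hpos)

/-- **Hermite–Biehler**: the real part of a polynomial without zeros in the open upper half-plane
has only real zeros. -/
theorem splits_rePart_of_stable {H : ℂ[X]} (h : ∀ z : ℂ, 0 < z.im → H.eval z ≠ 0) :
    (rePart H).Splits := by
  have hH : H.Splits := IsAlgClosed.splits H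
  have hroots : ∀ r ∈ H.roots, r.im ≤ 0 := fun r hr =>
    not_lt.1 fun hr' => h r hr' (mem_roots'.1 hr).2
  have hH0 : H ≠ 0 := by rintro rfl; exact h Complex.I (by simp) (by simp)
  by_cases hreal : ∀ r ∈ H.roots, r.im = 0
  · obtain ⟨s, hs⟩ : ∃ s : Multiset ℝ, s.map (algebraMap ℝ ℂ) = H.roots := by
      refine ⟨H.roots.map Complex.re, ?_⟩
      rw [Multiset.map_map]
      refine (Multiset.map_congr rfl fun r hr => ?_).trans (Multiset.map_id _)
      exact Complex.ext (by simp) (by simp [hreal r hr])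
    have hP : H = C H.leadingCoeff * toC (s.map (fun a => X - C a)).prod := by
      conv_lhs => rw [hH.eq_prod_roots, ← hs]
      simp [toC, Polynomial.map_multiset_prod]
    rw [show rePart H = C H.leadingCoeff.re * (s.map (fun a => X - C a)).prod by
      conv_lhs => rw [hP]
      ext k
      rw [coeff_rePart, coeff_C_mul, coeff_C_mul, coeff_map]
      simp]
    refine Splits.C_mul (Splits.multisetProd fun f hf => ?_) _
    obtain ⟨a, _, rfl⟩ := Multiset.mem_map.1 hf
    exact Splits.X_sub_C a
  -- At a zero of the real part, `H z = -conj (H (conj z))`, so the two moduli agree; a root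
  -- strictly below the axis forbids this.
  · refine splits_of_upper fun z hz h0 => ?_
    have h1 := two_mul_eval_rePart H z
    rw [h0, mul_zero] at h1
    have h2 : ‖H.eval (conj z)‖ = ‖H.eval z‖ := by
      rw [← Complex.norm_conj, eq_neg_of_add_eq_zero_right h1.symm, norm_neg]
    rcases norm_conj_sub_prod_lt H.roots hroots hz with h3 | h3
    · exact hreal h3
    · rw [hH.eval_eq_prod_roots, hH.eval_eq_prod_roots, norm_mul, norm_mul] at h2
      exact h3.ne (mul_left_cancel₀ (by simpa using hH0) h2)

/-- The evaluation pairing `Im (F(z) * conj G(z))` of two real polynomials. -/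
noncomputable def imPairing (F G : ℝ[X]) (z : ℂ) : ℝ := ((toC F).eval z * conj ((toC G).eval z)).im

lemma continuous_imPairing (F G : ℝ[X]) : Continuous (imPairing F G) := by
  unfold imPairing
  fun_prop

/-- The hypothesis says that `a` and `b` are parallel over `ℝ`: for `b ≠ 0`, `a * conj b` is real,
and multiplying `a` by `|b|²` gives that real number times `b`. -/
lemma exists_real_combination_eq_zero (a b : ℂ) (h : (a * conj b).im = 0) :
    ∃ α β : ℝ, (α ≠ 0 ∨ β ≠ 0) ∧ (α : ℂ) * a + β * b = 0 := by
  by_cases hb : b = 0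
  · exact ⟨0, 1, by simp [hb]⟩
  · refine ⟨Complex.normSq b, -(a * conj b).re, Or.inl (by simpa using hb), ?_⟩
    have h1 : ((a * conj b).re : ℂ) = a * conj b := Complex.ext (by simp) (by rw [h]; simp)
    push_cast
    rw [h1, ← Complex.mul_conj]
    ring

/-- Two real polynomials all of whose real combinations are real-rooted are dependent as soon as
their pairing vanishes at a point of the upper half-plane. -/
lemma exists_combination_eq_zero {F G : ℝ[X]}
    (h : ∀ α β : ℝ, (C α * F + C β * G).Splits) {z : ℂ} (hz : 0 < z.im)
    (h0 : imPairing F G z = 0) :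
    ∃ α β : ℝ, (α ≠ 0 ∨ β ≠ 0) ∧ C α * F + C β * G = 0 := by
  obtain ⟨α, β, hαβ, h1⟩ := exists_real_combination_eq_zero _ _ h0
  refine ⟨α, β, hαβ, ?_⟩
  by_contra hne
  refine eval_toC_ne_zero (h α β) hne hz.ne' ?_
  simpa using h1

/-- The pairing is real bilinear and alternating. With `exists_combination_eq_zero`, in a
real-rooted pencil a zero of the pairing in the upper half-plane spreads to every point. -/
lemma imPairing_eq_zero_of_combination {F G : ℝ[X]} {α β : ℝ} (hαβ : α ≠ 0 ∨ β ≠ 0)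
    (h : C α * F + C β * G = 0) (z : ℂ) : imPairing F G z = 0 := by
  have h1 : (α : ℂ) * (toC F).eval z + β * (toC G).eval z = 0 := by
    have := congrArg (fun P => (toC P).eval z) h
    simpa using this
  unfold imPairing
  set a := (toC F).eval z
  set b := (toC G).eval z
  have hr := congrArg Complex.re h1
  have hi := congrArg Complex.im h1
  simp at hr hi
  simp only [Complex.mul_im, Complex.conj_re, Complex.conj_im]
  rcases hαβ with h | h
  · refine mul_left_cancel₀ h ?_
    linear_combination b.re * hi - b.im * hr
  · refine mul_left_cancel₀ h ?_
    linear_combination a.im * hr - a.re * hi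

lemma isPreconnected_upper : IsPreconnected {z : ℂ | 0 < z.im} :=
  (convex_halfSpace_im_gt 0).isPreconnected

lemma isPreconnected_lower : IsPreconnected {z : ℂ | z.im < 0} :=
  (convex_halfSpace_im_lt 0).isPreconnected

lemma pos_of_preconnected {S : Set ℂ} (hS : IsPreconnected S) {f : ℂ → ℝ} (hf : Continuous f)
    (h0 : ∀ z ∈ S, f z ≠ 0) {w : ℂ} (hw : w ∈ S) (hpos : 0 < f w) : ∀ z ∈ S, 0 < f z := by
  intro z hz
  by_contra hneg
  obtain ⟨c, hc, hc0⟩ := hS.intermediate_value hz hw hf.continuousOn ⟨not_lt.1 hneg, hpos.le⟩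
  exact h0 c hc hc0

/-- The pairing has constant sign on the upper half-plane. -/
lemma imPairing_pos {F G : ℝ[X]} (h : ∀ α β : ℝ, (C α * F + C β * G).Splits) {w : ℂ}
    (hw : 0 < w.im) (hpos : 0 < imPairing F G w) {z : ℂ} (hz : 0 < z.im) :
    0 < imPairing F G z := by
  refine pos_of_preconnected isPreconnected_upper (continuous_imPairing F G) (fun c hc hc0 => ?_)
    hw hpos z hz
  obtain ⟨α, β, hαβ, h1⟩ := exists_combination_eq_zero h hc hc0
  exact hpos.ne' (imPairing_eq_zero_of_combination hαβ h1 w)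

/-- Polarization `|a + ib|² - |a - ib|² = 4 Im (a * conj b)`: for real `F`, `G` the value of `F +
iG` at `conj z` is conjugate to that of `F - iG` at `z`. A positive pairing therefore excludes zeros
of `F + iG`. -/
lemma imPairing_eq (F G : ℝ[X]) (z : ℂ) :
    4 * imPairing F G z = Complex.normSq ((toC F + C Complex.I * toC G).eval z) -
      Complex.normSq ((toC F + C Complex.I * toC G).eval (conj z)) := by
  simp only [eval_add, eval_mul, eval_C, eval_toC_conj, imPairing, Complex.normSq_apply]
  simp
  ring

/-- **Hurwitz** for polynomials of bounded degree: a pointwise limit of polynomials without zeros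
in an open set is zero or has no zeros there. -/
theorem eq_zero_of_tendsto_of_isRoot {N : ℕ} {U : Set ℂ} (hU : IsOpen U) {ι : Type*} {l : Filter ι}
    [l.NeBot] {Q : ι → ℂ[X]} {P : ℂ[X]} (hdeg : ∀ i, (Q i).natDegree ≤ N)
    (hlim : ∀ x, Tendsto (fun i => (Q i).eval x) l (𝓝 (P.eval x)))
    (hne : ∀ᶠ i in l, ∀ x ∈ U, (Q i).eval x ≠ 0) {x₀ : ℂ} (hx₀ : x₀ ∈ U) (h0 : P.eval x₀ = 0) :
    P = 0 := by
  obtain ⟨r, hr, hball⟩ := Metric.isOpen_iff.1 hU x₀ hx₀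
  have key : ∀ x ∈ Metric.ball x₀ r, P.eval x = 0 := by
    intro x hx
    -- All roots of `Q i` are at distance at least `r` from `x₀`, so moving from `x₀` to `x` at most
    -- doubles each factor. The bound survives the limit and forces `P` to vanish on the ball.
    have hbound : ∀ᶠ i in l, ‖(Q i).eval x‖ ≤ 2 ^ N * ‖(Q i).eval x₀‖ := by
      filter_upwards [hne] with i hi
      have hs := IsAlgClosed.splits (Q i)
      have hQ : Q i ≠ 0 := by intro h; exact hi x₀ hx₀ (by simp [h])
      rw [hs.eval_eq_prod_roots, hs.eval_eq_prod_roots, norm_mul, norm_mul, mul_left_comm]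
      refine mul_le_mul_of_nonneg_left ?_ (norm_nonneg _)
      have h1 : ∀ s : Multiset ℂ, (∀ a ∈ s, r ≤ ‖x₀ - a‖) →
          ‖(s.map (fun a => x - a)).prod‖ ≤ 2 ^ s.card * ‖(s.map (fun a => x₀ - a)).prod‖ := by
        intro s
        induction s using Multiset.induction_on with
        | empty => simp
        | cons a s ih =>
          intro hs
          simp only [Multiset.map_cons, Multiset.prod_cons, norm_mul, Multiset.card_cons, pow_succ]
          have h2 : ‖x - a‖ ≤ 2 * ‖x₀ - a‖ := by
            have h3 := hs a (Multiset.mem_cons_self a s)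
            have h4 : ‖x - x₀‖ < r := by simpa [dist_eq_norm] using hx
            have h5 : ‖x - a‖ ≤ ‖x - x₀‖ + ‖x₀ - a‖ := by
              simpa using norm_add_le (x - x₀) (x₀ - a)
            linarith
          calc _ ≤ (2 * ‖x₀ - a‖) * (2 ^ s.card * ‖(s.map (fun a => x₀ - a)).prod‖) := by
                refine mul_le_mul h2 (ih fun b hb => hs b (Multiset.mem_cons_of_mem hb))
                  (norm_nonneg _) (by positivity)
            _ = _ := by ring
      refine (h1 _ fun a ha => ?_).trans
        (mul_le_mul_of_nonneg_right (pow_le_pow_right₀ one_le_two ?_) (norm_nonneg _))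
      · by_contra hlt
        refine hi a (hball ?_) (mem_roots'.1 ha).2
        rw [Metric.mem_ball, dist_comm, dist_eq_norm]
        exact not_le.1 hlt
      · exact (card_roots' _).trans (hdeg i)
    have h1 := le_of_tendsto_of_tendsto (hlim x).norm ((hlim x₀).norm.const_mul (2 ^ N)) hbound
    rw [h0, norm_zero, mul_zero] at h1
    exact norm_le_zero_iff.1 h1
  refine eq_zero_of_infinite_isRoot P (Set.Infinite.mono (fun x hx => key x hx) ?_)
  exact infinite_of_mem_nhds x₀ (Metric.ball_mem_nhds x₀ hr)

end

/-! ### Laguerre's theorem and Grace–Walsh. -/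

section


lemma sum_normSq_bound (s : Multiset ℂ) {k : ℝ} {b : ℂ}
    (h : ∀ u ∈ s, k * Complex.normSq u + 2 * (b * u).re ≤ 1) :
    k * (s.map Complex.normSq).sum + 2 * (b * s.sum).re ≤ s.card := by
  induction s using Multiset.induction_on with
  | empty => simp
  | cons a s ih =>
    have h1 := h a (Multiset.mem_cons_self a s)
    have h2 := ih fun u hu => h u (Multiset.mem_cons_of_mem hu)
    simp only [Multiset.map_cons, Multiset.sum_cons, Multiset.card_cons, mul_add, Complex.add_re]
    push_cast
    linarith

/-- Cauchy–Schwarz: `key` sums `0 ≤ |w - a|²` over `a`, and `w` is then taken to be the mean. -/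
lemma normSq_sum_le (s : Multiset ℂ) :
    Complex.normSq s.sum ≤ s.card * (s.map Complex.normSq).sum := by
  have key : ∀ w : ℂ, 2 * (conj w * s.sum).re ≤ s.card * Complex.normSq w +
      (s.map Complex.normSq).sum := by
    intro w
    induction s using Multiset.induction_on with
    | empty => simp
    | cons a s ih =>
      simp only [Multiset.map_cons, Multiset.sum_cons, Multiset.card_cons, mul_add, Complex.add_re]
      have h1 : 0 ≤ Complex.normSq (w - a) := Complex.normSq_nonneg _
      simp only [Complex.normSq_apply, Complex.mul_re, Complex.conj_re, Complex.conj_im,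
        Complex.sub_re, Complex.sub_im] at ih h1 ⊢
      push_cast
      nlinarith
  by_cases h0 : s.card = 0
  · rw [Multiset.card_eq_zero] at h0
    simp [h0]
  have hpos : (0 : ℝ) < s.card := by positivity
  have h1 := key (s.sum / s.card)
  rw [Complex.normSq_div, map_div₀, Complex.conj_natCast, Complex.normSq_natCast,
    div_mul_eq_mul_div, ← Complex.normSq_eq_conj_mul_self, ← Complex.ofReal_natCast,
    ← Complex.ofReal_div, Complex.ofReal_re] at h1
  field_simp at h1
  nlinarith

/-- **Laguerre's theorem**: the polar derivative of a polynomial without roots in a disc, taken at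
a point of the disc, has no roots in the disc. -/
theorem polar_derivative_ne_zero {F : ℂ[X]} {N : ℕ} (hN : N ≠ 0) (hdeg : F.natDegree ≤ N)
    {c : ℂ} {R : ℝ} (hF : ∀ z ∈ Metric.ball c R, F.eval z ≠ 0) {z w : ℂ}
    (hz : z ∈ Metric.ball c R) (hw : w ∈ Metric.ball c R) :
    N * F.eval z + (w - z) * F.derivative.eval z ≠ 0 := by
  intro h
  have hFz := hF z hz
  have hNC : (N : ℂ) ≠ 0 := by exact_mod_cast hN
  have hNR : (0 : ℝ) < N := by positivity
  have hzw : z - w ≠ 0 := by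
    intro h0
    rw [← neg_sub, h0] at h
    simp [hNC, hFz] at h
  have hR : 0 < R := dist_nonneg.trans_lt hz
  have hsq : ∀ x ∈ Metric.ball c R, Complex.normSq (x - c) < R ^ 2 := fun x hx => by
    rw [Complex.normSq_eq_norm_sq]
    exact pow_lt_pow_left₀ (by simpa [dist_eq_norm] using hx) (norm_nonneg _) two_ne_zero
  set k : ℝ := R ^ 2 - Complex.normSq (z - c) with hk
  have hk0 : 0 < k := sub_pos.2 (hsq z hz)
  have hF0 : F ≠ 0 := by rintro rfl; simp at hFz
  have hdiv := (IsAlgClosed.splits F).eval_derivative_div_eval_of_ne_zero hFz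
  set s := F.roots.map (fun r => 1 / (z - r)) with hs
  have hsum : s.sum = N / (z - w) := by
    rw [← hdiv, div_eq_div_iff hFz hzw]
    linear_combination -h
  -- As `z` is in the ball, `r ↦ 1 / (z - r)` sends the outside of the ball into the disc `k |u|² +
  -- 2 Re ((z - c) u) ≤ 1`. The vanishing polar derivative says that `1 / (z - w)` is the mean of
  -- `N` points of that convex set, missing roots counting as `∞` with image `0`. But `w` lies
  -- inside the ball, which puts `1 / (z - w)` outside the disc.
  have expand : ∀ u r : ℂ, u * (z - r) = 1 →
      k * Complex.normSq u + 2 * ((z - c) * u).re - 1 =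
        (R ^ 2 - Complex.normSq (r - c)) * Complex.normSq u := by
    intro u r hu
    have hr : (r - c) * u = (z - c) * u - 1 := by linear_combination -hu
    have h1 : Complex.normSq (r - c) * Complex.normSq u = Complex.normSq ((z - c) * u - 1) := by
      rw [← Complex.normSq_mul, hr]
    have h2 : Complex.normSq ((z - c) * u - 1) =
        Complex.normSq (z - c) * Complex.normSq u - 2 * ((z - c) * u).re + 1 := by
      rw [Complex.normSq_sub, Complex.normSq_mul]
      simp
      ring
    rw [hk]
    linear_combination h1 + h2
  have hbound : ∀ u ∈ s, k * Complex.normSq u + 2 * ((z - c) * u).re ≤ 1 := by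
    intro u hu
    obtain ⟨r, hr, rfl⟩ := Multiset.mem_map.1 hu
    have hr0 : F.eval r = 0 := (mem_roots'.1 hr).2
    have hzr : z - r ≠ 0 := by
      intro h0
      rw [← sub_eq_zero.1 h0] at hr0
      exact hFz hr0
    have h1 := expand (1 / (z - r)) r (by field_simp)
    have h2 : R ^ 2 ≤ Complex.normSq (r - c) := by
      rw [Complex.normSq_eq_norm_sq]
      refine pow_le_pow_left₀ hR.le ?_ 2
      by_contra hlt
      exact hF r (by simpa [dist_eq_norm] using hlt) hr0
    nlinarith [Complex.normSq_nonneg (1 / (z - r))]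
  have h1 := sum_normSq_bound s hbound
  have h2 := normSq_sum_le s
  have hcard : s.card ≤ N := by
    rw [hs, Multiset.card_map]
    exact (card_roots' F).trans hdeg
  have hcardR : (s.card : ℝ) ≤ N := by exact_mod_cast hcard
  set v : ℂ := 1 / (z - w) with hv
  have hsv : s.sum = N * v := by rw [hsum, hv]; ring
  have h3 := expand v w (by rw [hv]; field_simp)
  have h4 : 0 < Complex.normSq v := Complex.normSq_pos.2 (by rw [hv]; exact one_div_ne_zero hzw)
  have h5 : 0 < (R ^ 2 - Complex.normSq (w - c)) * Complex.normSq v :=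
    mul_pos (sub_pos.2 (hsq w hw)) h4
  have hS : 0 ≤ (s.map Complex.normSq).sum := Multiset.sum_nonneg fun x hx => by
    obtain ⟨y, _, rfl⟩ := Multiset.mem_map.1 hx
    exact Complex.normSq_nonneg y
  rw [hsv, Complex.normSq_mul, Complex.normSq_natCast] at h2
  rw [hsv, mul_left_comm, ← Complex.ofReal_natCast, Complex.re_ofReal_mul] at h1
  have h6 : (N : ℝ) * Complex.normSq v ≤ (s.map Complex.normSq).sum := by
    have : (N : ℝ) * (N * Complex.normSq v) ≤ N * (s.map Complex.normSq).sum := by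
      nlinarith [mul_le_mul_of_nonneg_right hcardR hS]
    exact le_of_mul_le_mul_left this hNR
  nlinarith [mul_le_mul_of_nonneg_left h6 hk0.le]

/-- The polynomial `z ↦ L ((z - X) ^ n)`. -/
noncomputable def powerPoly (L : ℂ[X] →ₗ[ℂ] ℂ) (n : ℕ) : ℂ[X] :=
  ∑ k ∈ Finset.range (n + 1), monomial k ((n.choose k : ℂ) * L ((-X) ^ (n - k)))

lemma eval_powerPoly (L : ℂ[X] →ₗ[ℂ] ℂ) (n : ℕ) (z : ℂ) :
    (powerPoly L n).eval z = L ((C z - X) ^ n) := by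
  rw [sub_eq_add_neg, add_pow, map_sum, powerPoly, eval_finsetSum]
  refine Finset.sum_congr rfl fun k _ => ?_
  rw [eval_monomial, show C z ^ k * (-X) ^ (n - k) * (n.choose k : ℂ[X]) =
    (z ^ k * (n.choose k : ℂ)) • ((-X) ^ (n - k) : ℂ[X]) by
      rw [smul_eq_C_mul, C_mul, C_pow, C_eq_natCast]; ring, map_smul, smul_eq_mul]
  ring

lemma natDegree_powerPoly_le (L : ℂ[X] →ₗ[ℂ] ℂ) (n : ℕ) : (powerPoly L n).natDegree ≤ n :=
  natDegree_sum_le_of_forall_le _ _ fun _ hk =>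
    (natDegree_monomial_le _).trans (Nat.lt_succ_iff.1 (Finset.mem_range.1 hk))

/-- This makes the polar derivative of `powerPoly L (n + 1)` at `z` with pole `w` equal to `(n + 1)
* L ((w - X) * (z - X) ^ n)`. -/
lemma derivative_powerPoly (L : ℂ[X] →ₗ[ℂ] ℂ) (n : ℕ) :
    derivative (powerPoly L (n + 1)) = C ((n : ℂ) + 1) * powerPoly L n := by
  rw [powerPoly, derivative_sum, Finset.sum_range_succ', powerPoly, Finset.mul_sum]
  simp only [derivative_monomial, CharP.cast_eq_zero, mul_zero, monomial_zero_right, add_zero]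
  refine Finset.sum_congr rfl fun k _ => ?_
  rw [C_mul_monomial, Nat.add_sub_cancel, Nat.add_sub_add_right]
  congr 1
  have h := Nat.add_one_mul_choose_eq n k
  have h' : ((n : ℂ) + 1) * n.choose k = (n + 1).choose (k + 1) * ((k : ℂ) + 1) := by
    exact_mod_cast h
  push_cast
  linear_combination -L ((-X) ^ (n - k)) * h'

/-- **Grace–Walsh**: a linear functional that does not vanish on the `n`-th powers `(z - X) ^ n`
with `z` in a disc does not vanish on products of `n` such factors. -/
theorem grace_ball {c : ℂ} {R : ℝ} (s : Multiset ℂ) (hs : ∀ z ∈ s, z ∈ Metric.ball c R)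
    (L : ℂ[X] →ₗ[ℂ] ℂ) (hL : ∀ z ∈ Metric.ball c R, L ((C z - X) ^ s.card) ≠ 0)
    (hball : (Metric.ball c R).Nonempty) :
    L (s.map (fun z => C z - X)).prod ≠ 0 := by
  induction s using Multiset.induction_on generalizing L with
  | empty =>
    obtain ⟨z, hz⟩ := hball
    simpa using hL z hz
  | cons w s ih =>
    rw [Multiset.map_cons, Multiset.prod_cons]
    -- The factor of `w` is absorbed into the functional; Laguerre's theorem shows that the new
    -- functional is still nonzero on the powers.
    refine ih (fun z hz => hs z (Multiset.mem_cons_of_mem hz))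
      (L ∘ₗ LinearMap.mulLeft ℂ (C w - X)) fun z hz => ?_
    set n := s.card
    rw [Multiset.card_cons] at hL
    have h1 := polar_derivative_ne_zero (N := n + 1) (Nat.succ_ne_zero n)
      (natDegree_powerPoly_le L (n + 1)) (fun x hx => by rw [eval_powerPoly]; exact hL x hx) hz
      (hs w (Multiset.mem_cons_self w s))
    rw [derivative_powerPoly, eval_mul, eval_C, eval_powerPoly, eval_powerPoly] at h1
    intro h0
    apply h1
    rw [LinearMap.comp_apply, LinearMap.mulLeft_apply] at h0
    have h2 : (C w - X) * (C z - X) ^ n = (C z - X) ^ (n + 1) + (w - z) • (C z - X) ^ n := by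
      rw [smul_eq_C_mul, C_sub]; ring
    rw [h2, map_add, map_smul, smul_eq_mul] at h0
    push_cast
    linear_combination ((n : ℂ) + 1) * h0

/-- Finitely many points of the lower half-plane together with a compact interval can be separated
by a disc from finitely many points of the closed upper half-plane off the interval. -/
lemma exists_separating_ball (s r : Finset ℂ) {p q : ℝ} (hpq : p ≤ q)
    (hs : ∀ z ∈ s, z.im < 0 ∨ (z.im = 0 ∧ p ≤ z.re ∧ z.re ≤ q))
    (hr : ∀ z ∈ r, 0 ≤ z.im ∧ ¬ (z.im = 0 ∧ p ≤ z.re ∧ z.re ≤ q)) :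
    ∃ (c : ℂ) (R : ℝ), (∀ z ∈ s, z ∈ Metric.ball c R) ∧ ∀ z ∈ r, z ∉ Metric.ball c R := by
  -- The ball will meet the real line in `(x - p) (x - q) < δ`; a small `δ` keeps the real points of
  -- `r` out.
  have h1 : ∀ᶠ δ : ℝ in 𝓝[>] 0, ∀ z ∈ r, z.im = 0 → δ ≤ (z.re - p) * (z.re - q) := by
    rw [Filter.eventually_all_finset]
    intro z hz
    by_cases h0 : z.im = 0
    · have h2 : 0 < (z.re - p) * (z.re - q) := by
        rcases lt_or_ge z.re p with h | h
        · exact mul_pos_of_neg_of_neg (by linarith) (by linarith)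
        · have h3 : q < z.re := not_le.1 fun h3 => (hr z hz).2 ⟨h0, h, h3⟩
          exact mul_pos (by linarith) (by linarith)
      filter_upwards [Ioo_mem_nhdsGT h2] with δ hδ _ using hδ.2.le
    · filter_upwards with δ h using absurd h h0
  obtain ⟨δ, hδ, hδ0⟩ := (h1.and self_mem_nhdsWithin).exists
  have hδ0 : 0 < δ := hδ0
  -- The power of `z` with respect to the circle centred at `(p + q) / 2 - iY`. As `Y` grows, the
  -- disc fills the lower half-plane while its trace on the real line stays fixed.
  let f : ℂ → ℝ → ℝ := fun z Y => (z.re - p) * (z.re - q) + z.im ^ 2 + 2 * z.im * Y - δ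
  have h2 : ∀ᶠ Y : ℝ in atTop, ∀ z ∈ s, f z Y < 0 := by
    rw [Filter.eventually_all_finset]
    intro z hz
    rcases hs z hz with h | ⟨h, hp, hq⟩
    · filter_upwards [eventually_gt_atTop
        (((z.re - p) * (z.re - q) + z.im ^ 2 - δ) / (-(2 * z.im)))] with Y hY
      rw [div_lt_iff₀ (by linarith)] at hY
      simp only [f]
      linarith
    · filter_upwards with Y
      simp only [f, h]
      nlinarith [mul_nonneg (sub_nonneg.2 hp) (sub_nonneg.2 hq)]
  have h3 : ∀ᶠ Y : ℝ in atTop, ∀ z ∈ r, 0 ≤ f z Y := by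
    rw [Filter.eventually_all_finset]
    intro z hz
    rcases (hr z hz).1.lt_or_eq with h | h
    · filter_upwards [eventually_ge_atTop
        ((δ - (z.re - p) * (z.re - q)) / (2 * z.im))] with Y hY
      rw [div_le_iff₀ (by linarith)] at hY
      simp only [f]
      nlinarith [sq_nonneg z.im]
    · filter_upwards with Y
      have := hδ z hz h.symm
      simp only [f, ← h]
      linarith
  obtain ⟨Y, ⟨hY2, hY3⟩, hY0⟩ := ((h2.and h3).and (eventually_ge_atTop 0)).exists
  have key : ∀ z : ℂ, z ∈ Metric.ball (⟨(p + q) / 2, -Y⟩ : ℂ)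
      (Real.sqrt (Y ^ 2 + ((q - p) / 2) ^ 2 + δ)) ↔ f z Y < 0 := by
    intro z
    rw [Metric.mem_ball, dist_eq_norm, Real.lt_sqrt (norm_nonneg _), ← Complex.normSq_eq_norm_sq,
      Complex.normSq_apply]
    simp only [Complex.sub_re, Complex.sub_im, f]
    rw [← sub_neg]
    refine iff_of_eq (congrArg (· < 0) ?_)
    ring
  exact ⟨_, _, fun z hz => (key z).2 (hY2 z hz), fun z hz h => ((key z).1 h).not_ge (hY3 z hz)⟩

lemma exists_Icc_of_finset {I : Set ℝ} (hI : I.OrdConnected) (hI' : I.Nonempty) (s : Finset ℝ)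
    (hs : ∀ t ∈ s, t ∈ I) : ∃ p q, p ≤ q ∧ Set.Icc p q ⊆ I ∧ ∀ t ∈ s, t ∈ Set.Icc p q := by
  rcases s.eq_empty_or_nonempty with rfl | hne
  · obtain ⟨t, ht⟩ := hI'
    exact ⟨t, t, le_rfl, by simpa using ht, by simp⟩
  · exact ⟨s.min' hne, s.max' hne, s.min'_le_max' hne,
      hI.out (hs _ (s.min'_mem hne)) (hs _ (s.max'_mem hne)),
      fun t ht => ⟨s.min'_le t ht, s.le_max' t ht⟩⟩

/-- The open lower half-plane together with a set of real numbers. -/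
def lowerUnion (I : Set ℝ) : Set ℂ := {z | z.im < 0 ∨ (z.im = 0 ∧ z.re ∈ I)}

/-- **Grace–Walsh** for the lower half-plane enlarged by an interval of the real line. -/
theorem grace_lowerUnion {I : Set ℝ} (hI : I.OrdConnected) (hI' : I.Nonempty) (s : Multiset ℂ)
    (hs : ∀ z ∈ s, z ∈ lowerUnion I) (L : ℂ[X] →ₗ[ℂ] ℂ)
    (hL : ∀ z ∈ lowerUnion I, L ((C z - X) ^ s.card) ≠ 0) :
    L (s.map (fun z => C z - X)).prod ≠ 0 := by
  classical
  set F := powerPoly L s.card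
  obtain ⟨t, ht⟩ := hI'
  have htI : (t : ℂ) ∈ lowerUnion I := Or.inr ⟨by simp, by simpa using ht⟩
  have hF0 : F ≠ 0 := by
    intro h0
    apply hL t htI
    rw [← eval_powerPoly]
    change F.eval (t : ℂ) = 0
    rw [h0, eval_zero]
  -- Finitely many real points fit in a compact subinterval of `I`. The point `t` is added so that
  -- the ball is nonempty even when `s` is empty.
  obtain ⟨p, q, hpq, hsub, hmem⟩ := exists_Icc_of_finset hI ⟨t, ht⟩
    (insert t ((s.toFinset.filter (fun z => z.im = 0)).image Complex.re)) (by
      intro x hx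
      rcases Finset.mem_insert.1 hx with rfl | hx
      · exact ht
      · obtain ⟨z, hz, rfl⟩ := Finset.mem_image.1 hx
        rw [Finset.mem_filter, Multiset.mem_toFinset] at hz
        rcases hs z hz.1 with h | h
        · exact absurd hz.2 h.ne
        · exact h.2)
  -- Keeping the roots of `F` out of the ball is exactly the hypothesis on powers in `grace_ball`.
  obtain ⟨c, R, hcs, hcr⟩ := exists_separating_ball (insert (t : ℂ) s.toFinset) F.roots.toFinset hpq
    (by
      intro z hz
      rcases Finset.mem_insert.1 hz with rfl | hz
      · right
        simpa using hmem t (Finset.mem_insert_self _ _)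
      · have hz' := hz
        rw [Multiset.mem_toFinset] at hz
        rcases hs z hz with h | h
        · exact Or.inl h
        · exact Or.inr ⟨h.1, hmem z.re (Finset.mem_insert_of_mem (Finset.mem_image_of_mem _
            (Finset.mem_filter.2 ⟨hz', h.1⟩)))⟩)
    (by
      intro z hz
      rw [Multiset.mem_toFinset, mem_roots hF0, IsRoot.def, eval_powerPoly] at hz
      refine ⟨not_lt.1 fun h => hL z (Or.inl h) hz, fun h => hL z (Or.inr ⟨h.1, hsub h.2⟩) hz⟩)
  refine grace_ball s (fun z hz => hcs z (Finset.mem_insert_of_mem (Multiset.mem_toFinset.2 hz))) L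
    (fun z hz h0 => hcr z ?_ hz) ⟨t, hcs t (Finset.mem_insert_self _ _)⟩
  rw [Multiset.mem_toFinset, mem_roots hF0, IsRoot.def, eval_powerPoly]
  exact h0

end

/-! ### Real-rootedness preservers and stability of the symbol in open half-planes. -/

section


/-- The value of a polynomial of degree at most `m`, viewed as a form of degree `m`, at a point of
the Riemann sphere. -/
noncomputable def evalAt (m : ℕ) (Q : OnePoint ℂ) : ℂ[X] →ₗ[ℂ] ℂ :=
  Q.elim (lcoeff ℂ m) leval

@[simp] lemma evalAt_infty (m : ℕ) (P : ℂ[X]) : evalAt m OnePoint.infty P = P.coeff m := rfl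

@[simp] lemma evalAt_coe (m : ℕ) (z : ℂ) (P : ℂ[X]) : evalAt m (z : OnePoint ℂ) P = P.eval z := rfl

/-- `B` is the complexification of the operator `A` on real polynomials, with values of degree at
most `m`. -/
structure IsComplexification (m : ℕ) (A : ℝ[X] →ₗ[ℝ] ℝ[X]) (B : ℂ[X] →ₗ[ℂ] ℂ[X]) : Prop where
  map_toC : ∀ P, B (toC P) = toC (A P)
  natDegree_le : ∀ P, (A P).natDegree ≤ m

namespace IsComplexification

variable {n m : ℕ} {A : ℝ[X] →ₗ[ℝ] ℝ[X]} {B : ℂ[X] →ₗ[ℂ] ℂ[X]}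

lemma apply_eq (h : IsComplexification m A B) (P : ℂ[X]) :
    B P = toC (A (rePart P)) + C Complex.I * toC (A (imPart P)) := by
  conv_lhs => rw [← rePart_add_imPart P]
  rw [map_add, ← smul_eq_C_mul, map_smul, h.map_toC, h.map_toC, smul_eq_C_mul]

lemma natDegree_apply_le (h : IsComplexification m A B) (P : ℂ[X]) : (B P).natDegree ≤ m := by
  rw [h.apply_eq]
  refine natDegree_add_le_of_degree_le ?_ ((natDegree_C_mul_le _ _).trans ?_)
  · exact natDegree_map_le.trans (h.natDegree_le _)
  · exact natDegree_map_le.trans (h.natDegree_le _)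

end IsComplexification

/-- The expression is a polynomial in `ε`, so no topology on `ℂ[X]` is involved. -/
lemma continuous_linear_eval_C (L : ℂ[X] →ₗ[ℂ] ℂ) (W : ℂ[X][X]) :
    Continuous fun ε : ℂ => L (W.eval (C ε)) := by
  have h : ∀ ε : ℂ, L (W.eval (C ε)) =
      ∑ j ∈ Finset.range (W.natDegree + 1), ε ^ j * L (W.coeff j) := by
    intro ε
    rw [eval_eq_sum_range, map_sum]
    refine Finset.sum_congr rfl fun j _ => ?_
    rw [← C_pow, mul_comm, ← smul_eq_C_mul, map_smul, smul_eq_mul]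
  simp_rw [h]
  fun_prop

/-- A real-rooted polynomial of degree at most `n` as a limit of polynomials with `n` roots in the
open lower half-plane. -/
lemma exists_lower_approximation {P : ℝ[X]} (hP : P.Splits) (h0 : P ≠ 0) {n : ℕ}
    (hn : P.natDegree ≤ n) :
    ∃ (c : ℝ → ℂ) (s : ℝ → Multiset ℂ),
      (∀ ε > 0, c ε ≠ 0 ∧ (s ε).card = n ∧ ∀ z ∈ s ε, z.im < 0) ∧
      ∀ L : ℂ[X] →ₗ[ℂ] ℂ, Tendsto (fun ε => L (c ε • ((s ε).map (fun z => C z - X)).prod))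
        (𝓝[>] 0) (𝓝 (L (toC P))) := by
  set t := P.roots with ht
  have hcard : t.card = P.natDegree := hP.natDegree_eq_card_roots.symm
  set e := n - P.natDegree
  -- The outer variable is `ε`: each root `r` moves to `r - iε`, and the factors `1 - iεX` supply
  -- the missing roots `-i/ε`, which come from `∞`.
  let W : ℂ[X][X] := C (C (P.leadingCoeff : ℂ)) *
    (t.map (fun r : ℝ => (C (X - C (r : ℂ)) + C (C Complex.I) * X : ℂ[X][X]))).prod *
      (1 - C (C Complex.I * X) * X) ^ e
  have hW0 : W.eval (C 0) = toC P := by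
    conv_rhs => rw [hP.eq_prod_roots]
    simp [W, toC, Polynomial.map_multiset_prod, eval_multiset_prod, ht]
  have hW : ∀ ε : ℝ, ε ≠ 0 → W.eval (C (ε : ℂ)) =
      ((P.leadingCoeff : ℂ) * (-1) ^ t.card * (Complex.I * ε) ^ e) •
        (((t.map (fun r : ℝ => (r : ℂ) - Complex.I * ε) +
          Multiset.replicate e (-Complex.I / ε)).map (fun z => C z - X)).prod) := by
    intro ε hε
    have hε' : (ε : ℂ) ≠ 0 := by exact_mod_cast hε
    have h1 : (1 - C (Complex.I * ε) * X : ℂ[X]) =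
        C (Complex.I * ε) * (C (-Complex.I / ε) - X) := by
      rw [mul_sub, ← C_mul, show Complex.I * ε * (-Complex.I / ε) = 1 by
        field_simp; simp, C_1]
    have h2 : (t.map (fun r : ℝ => (X - C (r : ℂ) + C Complex.I * C (ε : ℂ) : ℂ[X]))).prod =
        (-1) ^ t.card * (t.map (fun r : ℝ => (C ((r : ℂ) - Complex.I * ε) - X : ℂ[X]))).prod := by
      induction t using Multiset.induction_on with
      | empty => simp
      | cons a u ih =>
        rw [Multiset.map_cons, Multiset.prod_cons, Multiset.map_cons, Multiset.prod_cons,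
          Multiset.card_cons, ih, C_sub, C_mul]
        ring
    rw [Multiset.map_add, Multiset.prod_add, Multiset.map_replicate, Multiset.prod_replicate,
      Multiset.map_map]
    simp only [W, eval_mul, eval_C, eval_multiset_prod, Multiset.map_map, Function.comp_def,
      eval_add, eval_X, eval_pow, eval_sub, eval_one]
    rw [h2, show (C Complex.I * X * C (ε : ℂ) : ℂ[X]) = C (Complex.I * ε) * X by
      rw [C_mul]; ring, h1, smul_eq_C_mul, show (C ((P.leadingCoeff : ℂ) * (-1) ^ t.card *
        (Complex.I * ε) ^ e) : ℂ[X]) = C (P.leadingCoeff : ℂ) * (-1) ^ t.card *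
          C (Complex.I * ε) ^ e by rw [C_mul, C_mul, C_pow, C_pow, C_neg, C_1], mul_pow]
    generalize (t.map (fun r : ℝ => (C ((r : ℂ) - Complex.I * ε) - X : ℂ[X]))).prod = M
    ring
  refine ⟨fun ε => (P.leadingCoeff : ℂ) * (-1) ^ t.card * (Complex.I * ε) ^ e,
    fun ε => t.map (fun r : ℝ => (r : ℂ) - Complex.I * ε) +
      Multiset.replicate e (-Complex.I / ε), fun ε hε => ⟨?_, ?_, ?_⟩, fun L => ?_⟩
  · simp [h0, (ne_of_gt hε : ε ≠ 0)]
  · rw [Multiset.card_add, Multiset.card_map, Multiset.card_replicate, hcard]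
    exact Nat.add_sub_cancel' hn
  · intro z hz
    rcases Multiset.mem_add.1 hz with hz | hz
    · obtain ⟨r, _, rfl⟩ := Multiset.mem_map.1 hz
      simpa using hε
    · rw [Multiset.eq_of_mem_replicate hz, Complex.div_ofReal_im]
      simpa [neg_div] using hε
  · rw [← hW0]
    have h1 : Tendsto (fun ε : ℝ => L (W.eval (C (ε : ℂ)))) (𝓝[>] 0) (𝓝 (L (W.eval (C 0)))) := by
      have := ((continuous_linear_eval_C L W).comp Complex.continuous_ofReal).tendsto 0
      simp only [Function.comp_apply, Complex.ofReal_zero] at this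
      exact this.mono_left nhdsWithin_le_nhds
    refine h1.congr' ?_
    filter_upwards [self_mem_nhdsWithin] with ε hε
    rw [hW ε (ne_of_gt hε)]

/-- Taylor expansion at `z`: above the axis `‖x - z‖ ≥ d`, so every lower power of `‖x - z‖` is
bounded by a constant times the `n`-th. The summand `1` makes the inequality strict. -/
lemma exists_norm_eval_lt {P : ℂ[X]} {n : ℕ} (hP : P.natDegree ≤ n) {z : ℂ} (hz : z.im < 0) :
    ∃ K : ℝ, 0 < K ∧ ∀ x : ℂ, 0 < x.im → ‖P.eval x‖ < K * ‖(z - x) ^ n‖ := by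
  set d := -z.im
  have hd : 0 < d := neg_pos.2 hz
  refine ⟨∑ k ∈ Finset.range (n + 1), ‖(taylor z P).coeff k‖ / d ^ (n - k) + 1, by positivity,
    fun x hx => ?_⟩
  have h1 : P.eval x = (taylor z P).eval (x - z) := by rw [taylor_eval, sub_add_cancel]
  have hdx : d ≤ ‖x - z‖ := by
    refine le_trans ?_ ((le_abs_self _).trans (Complex.abs_im_le_norm _))
    rw [Complex.sub_im]
    simp only [d]
    linarith
  have hpos : 0 < ‖(z - x) ^ n‖ := by
    rw [norm_pow, norm_sub_rev]
    exact pow_pos (hd.trans_le hdx) n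
  rw [add_mul, one_mul]
  refine lt_of_le_of_lt ?_ (lt_add_of_pos_right _ hpos)
  rw [h1, eval_eq_sum_range' (n := n + 1) (by rw [natDegree_taylor]; omega), Finset.sum_mul]
  refine (norm_sum_le _ _).trans (Finset.sum_le_sum fun k hk => ?_)
  have hk : k ≤ n := Nat.lt_succ_iff.1 (Finset.mem_range.1 hk)
  rw [norm_mul, norm_pow, norm_pow, norm_sub_rev z x, div_mul_eq_mul_div, mul_div_assoc]
  refine mul_le_mul_of_nonneg_left ?_ (norm_nonneg _)
  rw [le_div_iff₀ (by positivity), show ‖x - z‖ ^ n = ‖x - z‖ ^ k * ‖x - z‖ ^ (n - k) by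
    rw [← pow_add, Nat.add_sub_cancel' hk]]
  exact mul_le_mul_of_nonneg_left (pow_le_pow_left₀ hd.le hdx _) (by positivity)

variable {n m : ℕ} {A : ℝ[X] →ₗ[ℝ] ℝ[X]} {B : ℂ[X] →ₗ[ℂ] ℂ[X]}

/-- Stability of the symbol implies preservation of real-rootedness. -/
theorem splits_apply_of_stable (hAB : IsComplexification m A B) {I : Set ℝ} (hI : I.OrdConnected)
    (hI' : I.Nonempty) {U : Set ℂ} (hU : IsOpen U)
    (hUc : ∀ z : ℂ, z.im ≠ 0 → z ∈ U ∨ conj z ∈ U)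
    (hst : ∀ z ∈ lowerUnion I, ∀ x ∈ U, (B ((C z - X) ^ n)).eval x ≠ 0)
    {P : ℝ[X]} (hn : P.natDegree ≤ n) (hP : P.Splits) : (A P).Splits := by
  by_cases hP0 : P = 0
  · rw [hP0, map_zero]; exact Splits.zero
  by_cases hA0 : A P = 0
  · rw [hA0]; exact Splits.zero
  obtain ⟨c, s, hcs, hlim⟩ := exists_lower_approximation hP hP0 hn
  have key : ∀ x ∈ U, (toC (A P)).eval x ≠ 0 := by
    intro x hx h0
    apply hA0
    refine (Polynomial.map_eq_zero (algebraMap ℝ ℂ)).1 ?_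
    rw [← toC, ← hAB.map_toC]
    -- Grace–Walsh makes the images of the approximants zero-free on `U`; a zero of the limit would
    -- make it identically zero.
    refine eq_zero_of_tendsto_of_isRoot hU (l := 𝓝[>] (0 : ℝ))
      (Q := fun ε => B (c ε • ((s ε).map (fun z => C z - X)).prod)) (x₀ := x)
      (fun ε => hAB.natDegree_apply_le _)
      (fun y => hlim (leval y ∘ₗ B)) ?_ hx (by rw [hAB.map_toC]; exact h0)
    filter_upwards [self_mem_nhdsWithin] with ε hε y hy
    obtain ⟨h1, h2, h3⟩ := hcs ε hε
    rw [map_smul, eval_smul, smul_eq_mul]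
    refine mul_ne_zero h1 (grace_lowerUnion hI hI' (s ε) (fun z hz => Or.inl (h3 z hz))
      (leval y ∘ₗ B) fun z hz => ?_)
    rw [h2]
    exact hst z hz y hy
  refine splits_of_upper fun z hz h0 => ?_
  rcases hUc z hz.ne' with h | h
  · exact key z h h0
  · exact key _ h (by rw [eval_toC_conj, h0, map_zero])

/-- A real operator all of whose values are real-rooted, or else with stable symbol. -/
theorem stable_or_stable_or_splits (hAB : IsComplexification m A B)
    (hA : ∀ P : ℝ[X], P.natDegree ≤ n → P.Splits → (A P).Splits) :
    (∀ z : ℂ, z.im < 0 → ∀ x : ℂ, 0 < x.im → (B ((C z - X) ^ n)).eval x ≠ 0) ∨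
    (∀ z : ℂ, z.im < 0 → ∀ x : ℂ, x.im < 0 → (B ((C z - X) ^ n)).eval x ≠ 0) ∨
    ∀ P : ℝ[X], P.natDegree ≤ n → (A P).Splits := by
  have hdegp : ∀ z : ℂ, ((C z - X) ^ n : ℂ[X]).natDegree ≤ n := fun z => by
    refine natDegree_pow_le.trans ?_
    have : (C z - X : ℂ[X]).natDegree ≤ 1 := by
      refine (natDegree_sub_le _ _).trans ?_
      simp
    simpa using Nat.mul_le_mul_left n this
  set F : ℂ → ℝ[X] := fun z => A (rePart ((C z - X) ^ n)) with hF
  set G : ℂ → ℝ[X] := fun z => A (imPart ((C z - X) ^ n)) with hG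
  have hB : ∀ z, B ((C z - X) ^ n) = toC (F z) + C Complex.I * toC (G z) :=
    fun z => hAB.apply_eq _
  have hre : ∀ (α β : ℝ) (H : ℂ[X]),
      rePart (C ((α : ℂ) - Complex.I * β) * H) = C α * rePart H + C β * imPart H := by
    intro α β H
    ext k
    rw [coeff_rePart, coeff_C_mul, coeff_add, coeff_C_mul, coeff_C_mul, coeff_rePart, coeff_imPart]
    simp
  -- A nonzero multiple of `(z - X) ^ n` has no zero above the axis, so Hermite–Biehler applies
  -- before `A` does.
  have hcomb : ∀ z : ℂ, z.im < 0 → ∀ α β : ℝ, (C α * F z + C β * G z).Splits := by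
    intro z hz α β
    by_cases h0 : α = 0 ∧ β = 0
    · simp [h0.1, h0.2]
    have h1 : C α * F z + C β * G z =
        A (rePart (C ((α : ℂ) - Complex.I * β) * (C z - X) ^ n)) := by
      rw [hre, map_add, ← smul_eq_C_mul, ← smul_eq_C_mul, ← smul_eq_C_mul, ← smul_eq_C_mul,
        map_smul, map_smul]
    rw [h1]
    refine hA _ ((natDegree_rePart_le _).trans ((natDegree_C_mul_le _ _).trans (hdegp z))) ?_
    refine splits_rePart_of_stable fun x hx => ?_
    rw [eval_mul, eval_C, eval_pow, eval_sub, eval_C, eval_X]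
    refine mul_ne_zero (fun h => h0 ?_) (pow_ne_zero _ fun h => ?_)
    · have h2 := congrArg Complex.re h
      have h3 := congrArg Complex.im h
      simp at h2 h3
      exact ⟨h2, h3⟩
    · rw [sub_eq_zero.1 h] at hz
      exact lt_asymm hz hx
  -- By `imPairing_eq` the pairing is a difference of squared moduli of polynomials in `z`.
  have hcont : Continuous fun z => imPairing (F z) (G z) Complex.I := by
    have h1 : ∀ z, imPairing (F z) (G z) Complex.I =
        (Complex.normSq ((powerPoly (leval Complex.I ∘ₗ B) n).eval z) -
          Complex.normSq ((powerPoly (leval (conj Complex.I) ∘ₗ B) n).eval z)) / 4 := by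
      intro z
      rw [eval_powerPoly, eval_powerPoly, eq_div_iff four_ne_zero, mul_comm, imPairing_eq, ← hB]
      rfl
    simp_rw [h1]
    have := Complex.continuous_normSq
    fun_prop
  by_cases hz : ∀ z ∈ {z : ℂ | z.im < 0}, imPairing (F z) (G z) Complex.I ≠ 0
  · have hmem : -Complex.I ∈ {z : ℂ | z.im < 0} := by simp
    rcases lt_or_gt_of_ne (hz _ hmem) with hneg | hpos
    · right; left
      have h1 : ∀ z ∈ {z : ℂ | z.im < 0}, 0 < -imPairing (F z) (G z) Complex.I :=
        pos_of_preconnected isPreconnected_lower hcont.neg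
          (fun z hz' => neg_ne_zero.2 (hz z hz')) hmem (neg_pos.2 hneg)
      intro z hz' x hx h0
      have hswap : ∀ w, imPairing (G z) (F z) w = -imPairing (F z) (G z) w := by
        intro w
        simp only [imPairing, Complex.mul_im, Complex.conj_re, Complex.conj_im]
        ring
      have h2 := imPairing_pos (F := G z) (G := F z) (w := Complex.I) (z := conj x)
        (fun α β => by rw [add_comm]; exact hcomb z hz' β α) (by simp)
        (by rw [hswap]; exact h1 z hz') (by simpa using hx)
      have h3 := imPairing_eq (F z) (G z) (conj x)
      rw [Complex.conj_conj, ← hB, h0, Complex.normSq_zero] at h3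
      rw [hswap] at h2
      linarith [Complex.normSq_nonneg (eval (conj x) (B ((C z - X) ^ n)))]
    · left
      have h1 := pos_of_preconnected isPreconnected_lower hcont hz hmem hpos
      intro z hz' x hx h0
      have h2 := imPairing_pos (w := Complex.I) (hcomb z hz') (by simp) (h1 z hz') hx
      have h3 := imPairing_eq (F z) (G z) x
      rw [← hB, h0, Complex.normSq_zero] at h3
      linarith [Complex.normSq_nonneg (eval (conj x) (B ((C z - X) ^ n)))]
  · right; right
    push Not at hz
    obtain ⟨z, hz, hz0⟩ := hz
    have hz : z.im < 0 := hz
    obtain ⟨α, β, hαβ, h0⟩ := exists_combination_eq_zero (hcomb z hz) (z := Complex.I) (by simp) hz0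
    set c : ℂ := (α : ℂ) - Complex.I * β with hc
    have hc0 : c ≠ 0 := by
      intro h
      have h2 := congrArg Complex.re h
      have h3 := congrArg Complex.im h
      simp [hc] at h2 h3
      rcases hαβ with h | h
      · exact h h2
      · exact h h3
    have hA0 : A (rePart (C c * (C z - X) ^ n)) = 0 := by
      rw [hre, map_add, ← smul_eq_C_mul, ← smul_eq_C_mul, map_smul, map_smul, smul_eq_C_mul,
        smul_eq_C_mul]
      exact h0
    intro P hP
    obtain ⟨K, hK0, hK⟩ : ∃ K : ℝ, 0 < K ∧ ∀ x : ℂ, 0 < x.im →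
        ‖(toC P).eval x‖ < K * ‖(z - x) ^ n‖ :=
      exists_norm_eval_lt (natDegree_map_le.trans hP) hz
    -- On the upper half-plane the second term is strictly smaller than the first, so `H` has no
    -- zero there. The first term has real part killed by `A`, which leaves a positive multiple of
    -- `A P`.
    set H : ℂ[X] := C c * (C z - X) ^ n + C ((‖c‖ / K : ℝ) : ℂ) * toC P with hH
    have hc1 : 0 < ‖c‖ := norm_pos_iff.2 hc0
    have hHs : (rePart H).Splits := splits_rePart_of_stable fun x hx h1 => by
      have h2 : c * (z - x) ^ n = -(((‖c‖ / K : ℝ) : ℂ) * (toC P).eval x) := by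
        rw [← add_eq_zero_iff_eq_neg, ← h1, hH]
        simp
      have h3 := congrArg norm h2
      rw [norm_neg, norm_mul, norm_mul, Complex.norm_real, Real.norm_of_nonneg (by positivity),
        div_mul_eq_mul_div, eq_div_iff hK0.ne', mul_assoc] at h3
      have h4 := mul_left_cancel₀ hc1.ne' h3
      have h5 := hK x hx
      rw [mul_comm K, h4] at h5
      exact lt_irrefl _ h5
    have hHdeg : (rePart H).natDegree ≤ n := (natDegree_rePart_le _).trans
      (natDegree_add_le_of_degree_le ((natDegree_C_mul_le _ _).trans (hdegp z))
        ((natDegree_C_mul_le _ _).trans (natDegree_map_le.trans hP)))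
    have h1 : rePart H = rePart (C c * (C z - X) ^ n) + (‖c‖ / K) • P := by
      rw [hH, map_add]
      congr 1
      ext k
      rw [coeff_rePart, coeff_C_mul, coeff_map, coeff_smul]
      simp
    have h2 := hA _ hHdeg hHs
    rw [h1, map_add, hA0, zero_add, map_smul, smul_eq_C_mul] at h2
    have h3 : A P = C ((‖c‖ / K)⁻¹) * (C (‖c‖ / K) * A P) := by
      rw [← mul_assoc, ← C_mul, inv_mul_cancel₀ (by positivity), C_1, one_mul]
    rw [h3]
    exact h2.C_mul _

/-- If the symbol is stable with respect to `U`, then at a boundary point of `U` it has no zeros in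
the lower half-plane, unless it vanishes identically. -/
theorem evalAt_ne_zero_of_limit {U : Set ℂ} {x₀ : OnePoint ℂ} {l : Filter ℂ} [l.NeBot]
    {c : ℂ → ℂ} (hst : ∀ z : ℂ, z.im < 0 → ∀ x ∈ U, (B ((C z - X) ^ n)).eval x ≠ 0)
    (hl : ∀ᶠ x in l, x ∈ U ∧ c x ≠ 0)
    (hlim : ∀ P : ℂ[X], Tendsto (fun x => c x * (B P).eval x) l (𝓝 (evalAt m x₀ (B P))))
    {t : ℂ} (ht : evalAt m x₀ (B ((C t - X) ^ n)) ≠ 0) {z : ℂ} (hz : z.im < 0) :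
    evalAt m x₀ (B ((C z - X) ^ n)) ≠ 0 := by
  intro h0
  apply ht
  -- Hurwitz is applied in `z`, with `x` tending to the boundary point; the factor `c x`
  -- renormalizes the values when that point is `∞`.
  have h1 : powerPoly (evalAt m x₀ ∘ₗ B) n = 0 := by
    refine eq_zero_of_tendsto_of_isRoot (U := {z : ℂ | z.im < 0}) (l := l)
      (isOpen_lt Complex.continuous_im continuous_const)
      (Q := fun x => powerPoly (c x • (leval x ∘ₗ B)) n) (x₀ := z)
      (fun x => natDegree_powerPoly_le _ n) (fun y => ?_) ?_ hz (by rw [eval_powerPoly]; exact h0)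
    · simp only [eval_powerPoly]
      exact hlim _
    · filter_upwards [hl] with x hx y hy
      rw [eval_powerPoly]
      exact mul_ne_zero hx.2 (hst y hy x hx.1)
  have h2 := eval_powerPoly (evalAt m x₀ ∘ₗ B) n t
  rw [h1, eval_zero] at h2
  exact h2.symm

/-- The normalized values of a polynomial of degree at most `m` tend to its `m`-th coefficient. -/
lemma tendsto_coeff {P : ℂ[X]} (hP : P.natDegree ≤ m) {ι : Type*} {l : Filter ι} {w : ι → ℂ}
    (hw : Tendsto w l (𝓝 0)) (hw0 : ∀ᶠ i in l, w i ≠ 0) :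
    Tendsto (fun i => w i ^ m * P.eval (w i)⁻¹) l (𝓝 (P.coeff m)) := by
  have h1 : ∀ v : ℂ, v ≠ 0 → v ^ m * P.eval v⁻¹ = (P.reflect m).eval v := by
    intro v hv
    let := invertibleOfNonzero (inv_ne_zero hv)
    have h2 := eval₂_reflect_mul_pow (RingHom.id ℂ) v⁻¹ m P hP
    rw [invOf_eq_inv, inv_inv] at h2
    rw [eval, eval, ← h2, inv_pow]
    field_simp
  have h2 : Tendsto (fun i => (P.reflect m).eval (w i)) l (𝓝 ((P.reflect m).eval 0)) :=
    ((P.reflect m).continuous.tendsto 0).comp hw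
  rw [← coeff_zero_eq_eval_zero, coeff_reflect, revAt_le m.zero_le, Nat.sub_zero] at h2
  refine h2.congr' ?_
  filter_upwards [hw0] with i hi using (h1 _ hi).symm

end

/-! ### Monotone motion of roots in a real-rooted pencil. -/

section


lemma imPairing_ofReal (F G : ℝ[X]) (x : ℝ) : imPairing F G x = 0 := by
  rw [imPairing, eval_toC_ofReal, eval_toC_ofReal, Complex.conj_ofReal, ← Complex.ofReal_mul,
    Complex.ofReal_im]

/-- The pairing vanishes on the real line and its vertical derivative is the Wronskian. Positivity
above the axis thus gives a nonnegative Wronskian, which makes `F / G` increasing. -/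
lemma hasDerivAt_imPairing (F G : ℝ[X]) (x : ℝ) :
    HasDerivAt (fun ε : ℝ => imPairing F G (x + ε * Complex.I))
      (F.derivative.eval x * G.eval x - F.eval x * G.derivative.eval x) 0 := by
  have hd : ∀ P : ℝ[X], HasDerivAt (fun ε : ℝ => (toC P).eval ((x : ℂ) + ε * Complex.I))
      (((P.derivative.eval x : ℝ) : ℂ) * Complex.I) 0 := by
    intro P
    have h1 : HasDerivAt (fun w : ℂ => (toC P).eval ((x : ℂ) + w * Complex.I))
        ((toC P).derivative.eval ((x : ℂ) + ((0 : ℝ) : ℂ) * Complex.I) * (1 * Complex.I))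
        ((0 : ℝ) : ℂ) :=
      HasDerivAt.comp _ ((toC P).hasDerivAt _) (((hasDerivAt_id _).mul_const _).const_add _)
    have h2 := h1.comp_ofReal
    rw [Complex.ofReal_zero, zero_mul, add_zero, toC, derivative_map, eval_toC_ofReal,
      one_mul] at h2
    exact h2
  have h := Complex.imCLM.hasFDerivAt.comp_hasDerivAt 0 ((hd F).mul (hd G).star)
  refine h.congr_deriv ?_
  rw [Complex.ofReal_zero, zero_mul, add_zero, eval_toC_ofReal, eval_toC_ofReal]
  simp
  ring

lemma wronskian_nonneg {F G : ℝ[X]} (h : ∀ z : ℂ, 0 < z.im → 0 < imPairing F G z) (x : ℝ) :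
    0 ≤ F.derivative.eval x * G.eval x - F.eval x * G.derivative.eval x := by
  have h1 := (hasDerivAt_imPairing F G x).tendsto_slope_zero_right
  refine ge_of_tendsto h1 ?_
  filter_upwards [self_mem_nhdsWithin] with ε hε
  have hε : 0 < ε := hε
  rw [zero_add, Complex.ofReal_zero, zero_mul, add_zero, imPairing_ofReal, sub_zero, smul_eq_mul]
  exact mul_nonneg (inv_nonneg.2 hε.le) (h _ (by simpa using hε)).le

lemma monotoneOn_ratio {F G : ℝ[X]} (h : ∀ z : ℂ, 0 < z.im → 0 < imPairing F G z) {s : Set ℝ}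
    (hs : Convex ℝ s) (hG : ∀ x ∈ s, G.eval x ≠ 0) :
    MonotoneOn (fun x => F.eval x / G.eval x) s := by
  refine monotoneOn_of_deriv_nonneg hs (F.continuousOn.div G.continuousOn hG)
    (fun x hx => ((F.differentiableAt).div G.differentiableAt
      (hG x (interior_subset hx))).differentiableWithinAt) fun x hx => ?_
  rw [((F.hasDerivAt x).fun_div (G.hasDerivAt x) (hG x (interior_subset hx))).deriv]
  exact div_nonneg (wronskian_nonneg h x) (sq_nonneg _)

/-- To the right of `x` the ratio increases towards its limit `0` at `+∞`; `ratio_nonneg` uses the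
limit at `-∞`. -/
lemma ratio_nonpos {F G : ℝ[X]} (h : ∀ z : ℂ, 0 < z.im → 0 < imPairing F G z)
    (hdeg : F.degree < G.degree) {x : ℝ} (hG : ∀ y, x ≤ y → G.eval y ≠ 0) :
    F.eval x / G.eval x ≤ 0 := by
  have h1 := monotoneOn_ratio h (convex_Ici x) hG
  refine ge_of_tendsto (F.div_tendsto_atTop_zero_of_degree_lt G hdeg) ?_
  filter_upwards [eventually_ge_atTop x] with y hy
  exact h1 (Set.mem_Ici.2 le_rfl) hy hy

lemma ratio_nonneg {F G : ℝ[X]} (h : ∀ z : ℂ, 0 < z.im → 0 < imPairing F G z)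
    (hdeg : F.degree < G.degree) {x : ℝ} (hG : ∀ y, y ≤ x → G.eval y ≠ 0) :
    0 ≤ F.eval x / G.eval x := by
  have h1 := monotoneOn_ratio h (convex_Iic x) hG
  refine le_of_tendsto (F.div_tendsto_atBot_zero_of_degree_lt G hdeg) ?_
  filter_upwards [eventually_le_atBot x] with y hy
  exact h1 hy (Set.mem_Iic.2 le_rfl) hy

/-- In a pencil of real-rooted polynomials, a multiple root of one member that is the only root of
this member is a root of every member. -/
lemma eval_eq_zero_of_imPairing_pow {F : ℝ[X]} {m : ℕ} (hm : 2 ≤ m) {a : ℝ}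
    (h : ∀ z : ℂ, 0 < z.im → 0 < imPairing F ((X - C a) ^ m) z) : F.eval a = 0 := by
  have hm0 : (0 : ℝ) < m := by positivity
  -- The leading behaviour of the pairing at `a + r z` as `r → 0`, after division by `r ^ m`.
  have key : ∀ z : ℂ, 0 < z.im → 0 ≤ F.eval a * (conj (z ^ m)).im := by
    intro z hz
    have h1 : Tendsto (fun r : ℝ => ((toC F).eval ((a : ℂ) + r * z) * conj (z ^ m)).im) (𝓝[>] 0)
        (𝓝 (F.eval a * (conj (z ^ m)).im)) := by
      have h2 : Continuous fun r : ℝ => ((toC F).eval ((a : ℂ) + r * z) * conj (z ^ m)).im := by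
        fun_prop
      have h3 := h2.tendsto 0
      rw [Complex.ofReal_zero, zero_mul, add_zero, eval_toC_ofReal, Complex.im_ofReal_mul] at h3
      exact h3.mono_left nhdsWithin_le_nhds
    refine ge_of_tendsto h1 ?_
    filter_upwards [self_mem_nhdsWithin] with r hr
    have hr : 0 < r := hr
    have h2 := h ((a : ℂ) + r * z) (by simpa using mul_pos hr hz)
    have h3 : imPairing F ((X - C a) ^ m) ((a : ℂ) + r * z) =
        r ^ m * ((toC F).eval ((a : ℂ) + r * z) * conj (z ^ m)).im := by
      rw [imPairing, ← Complex.im_ofReal_mul]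
      congr 1
      simp [toC]
      ring
    rw [h3] at h2
    exact (pos_of_mul_pos_right h2 (by positivity)).le
  have hexp : ∀ θ : ℝ, (Complex.exp ((θ / m : ℝ) * Complex.I)) ^ m = Complex.exp (θ * Complex.I) := by
    intro θ
    rw [← Complex.exp_nat_mul]
    congr 1
    push_cast
    have : (m : ℂ) ≠ 0 := by exact_mod_cast hm0.ne'
    field_simp
  have himexp : ∀ θ : ℝ, 0 < θ → θ < m * Real.pi →
      0 < (Complex.exp ((θ / m : ℝ) * Complex.I)).im := by
    intro θ h0 h1
    rw [Complex.exp_ofReal_mul_I_im]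
    refine Real.sin_pos_of_pos_of_lt_pi (by positivity) ?_
    rw [div_lt_iff₀ hm0]
    linarith
  have hm2 : (2 : ℝ) ≤ m := by exact_mod_cast hm
  have hpi := Real.pi_pos
  -- For `m ≥ 2` both `π/2` and `3π/2` are below `mπ`, so `z ^ m` takes the values `i` and `-i` with
  -- `z` above the axis, and `F(a)` has both weak signs.
  have k1 := key _ (himexp (Real.pi / 2) (by positivity) (by nlinarith))
  have k2 := key _ (himexp (Real.pi / 2 + Real.pi) (by positivity) (by nlinarith))
  rw [hexp, Complex.conj_im, Complex.exp_ofReal_mul_I_im] at k1 k2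
  rw [Real.sin_add_pi] at k2
  rw [Real.sin_pi_div_two] at k1 k2
  linarith

/-- A factorwise bound. Being a non-strict inequality, it passes to limits of polynomials, which
nonvanishing alone would not. -/
lemma pow_le_eval {P : ℝ[X]} (hP : P.Splits) (hmon : P.Monic) {b x : ℝ}
    (hb : ∀ r, P.IsRoot r → r ≤ b) (hx : b ≤ x) : (x - b) ^ P.natDegree ≤ P.eval x := by
  rw [hP.eval_eq_prod_roots_of_monic hmon, hP.natDegree_eq_card_roots,
    ← Multiset.prod_replicate, ← Multiset.map_const']
  refine Multiset.prod_map_le_prod_map₀ _ _ (fun _ _ => sub_nonneg.2 hx) fun r hr => ?_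
  linarith [hb r (mem_roots'.1 hr).2]

lemma pow_le_eval_left {P : ℝ[X]} (hP : P.Splits) (hmon : P.Monic) {a x : ℝ}
    (ha : ∀ r, P.IsRoot r → a ≤ r) (hx : x ≤ a) :
    (a - x) ^ P.natDegree ≤ (-1) ^ P.natDegree * P.eval x := by
  rw [hP.eval_eq_prod_roots_of_monic hmon, hP.natDegree_eq_card_roots, ← Multiset.card_map (fun r => x - r),
    ← Multiset.prod_map_neg, Multiset.map_map, Multiset.card_map,
    ← Multiset.prod_replicate, ← Multiset.map_const']
  refine Multiset.prod_map_le_prod_map₀ _ _ (fun _ _ => sub_nonneg.2 hx) fun r hr => ?_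
  simp only [Function.comp_apply]
  linarith [ha r (mem_roots'.1 hr).2]

lemma eval_le_pow {P : ℝ[X]} (hP : P.Splits) (hmon : P.Monic) {a b x : ℝ}
    (hroot : ∀ r, P.IsRoot r → r ∈ Set.Icc a b) (hx : b ≤ x) :
    P.eval x ≤ (x - a) ^ P.natDegree := by
  rw [hP.eval_eq_prod_roots_of_monic hmon, hP.natDegree_eq_card_roots,
    ← Multiset.prod_replicate, ← Multiset.map_const']
  refine Multiset.prod_map_le_prod_map₀ _ _ (fun r hr => ?_) fun r hr => ?_ <;>
  linarith [(hroot r (mem_roots'.1 hr).2).1, (hroot r (mem_roots'.1 hr).2).2]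

/-- The intervals under consideration: a bounded interval of positive length that does not contain
both of its endpoints. -/
structure IsHalfOpen (J : Set ℝ) (a b : ℝ) : Prop where
  lt : a < b
  Ioo_subset : Set.Ioo a b ⊆ J
  subset_Icc : J ⊆ Set.Icc a b
  notMem : a ∉ J ∨ b ∉ J
  closure_eq : closure J = Set.Icc a b

lemma isHalfOpen_of_eq {J : Set ℝ} {a b : ℝ} (hab : a < b)
    (hJ : J = Set.Ioo a b ∨ J = Set.Ico a b ∨ J = Set.Ioc a b) : IsHalfOpen J a b := by
  rcases hJ with rfl | rfl | rfl
  · exact ⟨hab, subset_rfl, Set.Ioo_subset_Icc_self, by simp, closure_Ioo hab.ne⟩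
  · exact ⟨hab, Set.Ioo_subset_Ico_self, Set.Ico_subset_Icc_self, by simp, closure_Ico hab.ne⟩
  · exact ⟨hab, Set.Ioo_subset_Ioc_self, Set.Ioc_subset_Icc_self, by simp, closure_Ioc hab.ne⟩

namespace IsHalfOpen

variable {J : Set ℝ} {a b : ℝ}

lemma le_or_ge (hJ : IsHalfOpen J a b) {x : ℝ} (hx : x ∉ J) : x ≤ a ∨ b ≤ x := by
  by_contra h
  push Not at h
  exact hx (hJ.Ioo_subset h)

lemma notMem_of_le (hJ : IsHalfOpen J a b) {x y : ℝ} (hx : x ∉ J) (hxa : x ≤ a) (hy : y ≤ x) :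
    y ∉ J := by
  intro h
  rcases hy.eq_or_lt with rfl | hlt
  · exact hx h
  · linarith [(hJ.subset_Icc h).1]

lemma notMem_of_ge (hJ : IsHalfOpen J a b) {x y : ℝ} (hx : x ∉ J) (hxb : b ≤ x) (hy : x ≤ y) :
    y ∉ J := by
  intro h
  rcases hy.eq_or_lt with rfl | hlt
  · exact hx h
  · linarith [(hJ.subset_Icc h).2]

lemma eq_or_eq (hJ : IsHalfOpen J a b) {x : ℝ} (hx : x ∉ J) (h : x ∈ Set.Icc a b) :
    x = a ∨ x = b := by
  rcases hJ.le_or_ge hx with h1 | h1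
  · exact Or.inl (le_antisymm h1 h.1)
  · exact Or.inr (le_antisymm h.2 h1)

end IsHalfOpen

/-- The pencil `u + t v` of monic real-rooted polynomials of degree `m`, whose roots move to the
right as `t` increases. -/
structure IsPencil (m : ℕ) (u v : ℝ[X]) : Prop where
  monic : u.Monic
  natDegree : u.natDegree = m
  degree_lt : v.degree < u.degree
  splits : ∀ t : ℝ, (u + C t * v).Splits
  pairing_pos : ∀ z : ℂ, 0 < z.im → 0 < imPairing v u z

namespace IsPencil

variable {m : ℕ} {u v : ℝ[X]} {J : Set ℝ} {a b : ℝ}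

lemma degree_C_mul_lt (h : IsPencil m u v) (t : ℝ) : (C t * v).degree < u.degree := by
  rw [← smul_eq_C_mul]
  exact (degree_smul_le t v).trans_lt h.degree_lt

lemma monic_add (h : IsPencil m u v) (t : ℝ) : (u + C t * v).Monic :=
  h.monic.add_of_left (h.degree_C_mul_lt t)

lemma natDegree_add (h : IsPencil m u v) (t : ℝ) : (u + C t * v).natDegree = m := by
  rw [natDegree_add_eq_left_of_degree_lt (h.degree_C_mul_lt t), h.natDegree]

lemma pairing_add_pos (h : IsPencil m u v) (t : ℝ) {z : ℂ} (hz : 0 < z.im) :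
    0 < imPairing v (u + C t * v) z := by
  refine (h.pairing_pos z hz).trans_eq ?_
  simp only [imPairing, toC, Polynomial.map_add, Polynomial.map_mul, map_C, eval_add, eval_mul,
    eval_C, Complex.coe_algebraMap, map_add, map_mul, Complex.conj_ofReal, Complex.mul_im,
    Complex.add_re, Complex.add_im, Complex.mul_re, Complex.ofReal_re, Complex.ofReal_im,
    Complex.conj_re, Complex.conj_im]
  ring

/-- The parameters of the `J`-rooted members of the pencil. -/
def params (u v : ℝ[X]) (J : Set ℝ) : Set ℝ := {t | ∀ x, (u + C t * v).IsRoot x → x ∈ J}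

/-- The member with parameter `0` is `u`, so `u` has no zero on the whole ray to the left of `x`. -/
lemma ratio_nonneg (h : IsPencil m u v) (hJ : IsHalfOpen J a b) (h0 : 0 ∈ params u v J) {x : ℝ}
    (hx : x ∉ J) (hxa : x ≤ a) : u.eval x ≠ 0 ∧ 0 ≤ v.eval x / u.eval x := by
  have h1 : ∀ y ≤ x, u.eval y ≠ 0 := fun y hy hy0 =>
    hJ.notMem_of_le hx hxa hy (h0 y (by simpa using hy0))
  exact ⟨h1 x le_rfl, BinaryForm.ratio_nonneg h.pairing_pos h.degree_lt h1⟩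

lemma ratio_nonpos (h : IsPencil m u v) (hJ : IsHalfOpen J a b) (h0 : 0 ∈ params u v J) {x : ℝ}
    (hx : x ∉ J) (hxb : b ≤ x) : u.eval x ≠ 0 ∧ v.eval x / u.eval x ≤ 0 := by
  have h1 : ∀ y, x ≤ y → u.eval y ≠ 0 := fun y hy hy0 =>
    hJ.notMem_of_ge hx hxb hy (h0 y (by simpa using hy0))
  exact ⟨h1 x le_rfl, BinaryForm.ratio_nonpos h.pairing_pos h.degree_lt h1⟩

lemma eval_ne_zero_of_ratio {x t : ℝ} (hu : u.eval x ≠ 0) (h : 0 < 1 + t * (v.eval x / u.eval x)) :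
    (u + C t * v).eval x ≠ 0 := by
  have h1 : (u + C t * v).eval x = u.eval x * (1 + t * (v.eval x / u.eval x)) := by
    simp only [eval_add, eval_mul, eval_C]
    field_simp
  rw [h1]
  exact mul_ne_zero hu h.ne'

/-- The missing endpoint gives the room to move. If `a ∉ J`, then `v / u` on `(-∞, a]` is bounded
above by its value at `a`, so a small negative `t` creates no root there, and on the right `v / u ≤
0` makes negative `t` harmless. If `b ∉ J`, a small positive `t` works. A member with roots at both
ends of a closed interval could be isolated. -/
lemma exists_params_ne_zero (h : IsPencil m u v) (hJ : IsHalfOpen J a b) (h0 : 0 ∈ params u v J) :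
    ∃ t ∈ params u v J, t ≠ 0 := by
  have hsmall : ∀ c : ℝ, c ≤ 0 → ∃ t : ℝ, 0 < t ∧ 0 < 1 + t * c := by
    intro c hc
    refine ⟨1 / (1 - c), by apply div_pos <;> linarith, ?_⟩
    have : 0 < 1 - c := by linarith
    field_simp
    linarith
  rcases hJ.notMem with hn | hn
  · obtain ⟨t, ht, hpos⟩ := hsmall (-(v.eval a / u.eval a))
      (neg_nonpos.2 (h.ratio_nonneg hJ h0 hn le_rfl).2)
    refine ⟨-t, fun x hx => ?_, (neg_neg_of_pos ht).ne⟩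
    by_contra hxJ
    rcases hJ.le_or_ge hxJ with hle | hge
    · have h1 := monotoneOn_ratio h.pairing_pos (convex_Iic a)
        (fun y hy hy0 => hJ.notMem_of_le hn le_rfl hy (h0 y (by simpa using hy0)))
        hle (Set.mem_Iic.2 le_rfl) hle
      exact eval_ne_zero_of_ratio (h.ratio_nonneg hJ h0 hxJ hle).1 (by nlinarith) hx
    · have h1 := h.ratio_nonpos hJ h0 hxJ hge
      exact eval_ne_zero_of_ratio h1.1 (by nlinarith [h1.2]) hx
  · obtain ⟨t, ht, hpos⟩ := hsmall (v.eval b / u.eval b) (h.ratio_nonpos hJ h0 hn le_rfl).2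
    refine ⟨t, fun x hx => ?_, ht.ne'⟩
    by_contra hxJ
    rcases hJ.le_or_ge hxJ with hle | hge
    · have h1 := h.ratio_nonneg hJ h0 hxJ hle
      exact eval_ne_zero_of_ratio h1.1 (by nlinarith [mul_nonneg ht.le h1.2]) hx
    · have h1 := monotoneOn_ratio h.pairing_pos (convex_Ici b)
        (fun y hy hy0 => hJ.notMem_of_ge hn le_rfl hy (h0 y (by simpa using hy0)))
        (Set.mem_Ici.2 le_rfl) hge hge
      exact eval_ne_zero_of_ratio (h.ratio_nonpos hJ h0 hxJ hge).1 (by nlinarith) hx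

/-- At a point `x ≥ b` with `v x ≠ 0`, the value `u x + t v x` of a `J`-rooted member lies in `[0,
(x - a) ^ m]`, which confines `t`. -/
lemma exists_bound (h : IsPencil m u v) (hJ : IsHalfOpen J a b) :
    ∃ K : ℝ, ∀ t ∈ params u v J, |t| ≤ K := by
  have hv : v ≠ 0 := by
    rintro rfl
    simpa [imPairing] using h.pairing_pos Complex.I (by simp)
  obtain ⟨x, hxb, hx⟩ : ∃ x, b ≤ x ∧ v.eval x ≠ 0 := by
    by_contra! hcon
    exact hv (eq_zero_of_infinite_isRoot v ((Set.Ici_infinite b).mono hcon))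
  refine ⟨((x - a) ^ m + |u.eval x|) / |v.eval x|, fun t ht => ?_⟩
  rw [le_div_iff₀ (abs_pos.2 hx), ← abs_mul]
  have h1 := eval_le_pow (h.splits t) (h.monic_add t) (fun r hr => hJ.subset_Icc (ht r hr)) hxb
  have h2 := pow_le_eval (h.splits t) (h.monic_add t)
    (fun r hr => (hJ.subset_Icc (ht r hr)).2) hxb
  have h3 : 0 ≤ (x - b) ^ m := pow_nonneg (sub_nonneg.2 hxb) m
  rw [h.natDegree_add] at h1 h2
  simp only [eval_add, eval_mul, eval_C] at h1 h2
  rw [abs_le]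
  constructor <;> linarith [le_abs_self (u.eval x), neg_abs_le (u.eval x),
    (h3.trans h2).trans h1]

/-- At a fixed `x` outside `[a, b]` the bounds of `pow_le_eval` and `pow_le_eval_left` are closed
conditions on `t` with a positive lower bound. -/
lemma mem_Icc_of_mem_closure (h : IsPencil m u v) (hJ : IsHalfOpen J a b) {t : ℝ}
    (ht : t ∈ closure (params u v J)) {x : ℝ} (hx : (u + C t * v).IsRoot x) :
    x ∈ Set.Icc a b := by
  rw [IsRoot.def, eval_add, eval_mul, eval_C] at hx
  constructor
  · by_contra! hlt
    have hcl : IsClosed {t : ℝ | (a - x) ^ m ≤ (-1) ^ m * (u.eval x + t * v.eval x)} :=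
      isClosed_le continuous_const (by fun_prop)
    have h1 := closure_minimal (fun t ht => by
      have h2 := pow_le_eval_left (h.splits t) (h.monic_add t)
        (fun r hr => (hJ.subset_Icc (ht r hr)).1) hlt.le
      rw [h.natDegree_add] at h2
      simpa using h2) hcl ht
    rw [Set.mem_ofPred_eq, hx, mul_zero] at h1
    exact (pow_pos (sub_pos.2 hlt) m).not_ge h1
  · by_contra! hlt
    have hcl : IsClosed {t : ℝ | (x - b) ^ m ≤ u.eval x + t * v.eval x} :=
      isClosed_le continuous_const (by fun_prop)
    have h1 := closure_minimal (fun t ht => by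
      have h2 := pow_le_eval (h.splits t) (h.monic_add t)
        (fun r hr => (hJ.subset_Icc (ht r hr)).2) hlt.le
      rw [h.natDegree_add] at h2
      simpa using h2) hcl ht
    rw [Set.mem_ofPred_eq, hx] at h1
    exact (pow_pos (sub_pos.2 hlt) m).not_ge h1

lemma eq_pow_of_unique_root {P : ℝ[X]} (hP : P.Splits) (hmon : P.Monic) {r : ℝ}
    (hr : ∀ x, P.IsRoot x → x = r) : P = (X - C r) ^ P.natDegree := by
  conv_lhs => rw [hP.eq_prod_roots_of_monic hmon]
  rw [hP.natDegree_eq_card_roots, ← Multiset.prod_replicate, ← Multiset.map_const']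
  congr 1
  exact Multiset.map_congr rfl fun x hx => by rw [hr x (mem_roots'.1 hx).2]

lemma exists_isRoot {P : ℝ[X]} (hP : P.Splits) (hdeg : P.natDegree ≠ 0) : ∃ r, P.IsRoot r := by
  obtain ⟨r, hr⟩ := hP.exists_eval_eq_zero (fun h => hdeg (natDegree_eq_of_degree_eq_some h))
  exact ⟨r, hr⟩

/-- A full collapse to `r` would make `r` a root of `v`, hence of `u`, whose roots lie in `J`. -/
lemma not_pow (h : IsPencil m u v) (h0 : 0 ∈ params u v J) (hm : 2 ≤ m) {t r : ℝ} (hr : r ∉ J) :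
    u + C t * v ≠ (X - C r) ^ m := by
  intro heq
  have h1 : v.eval r = 0 := eval_eq_zero_of_imPairing_pow hm fun z hz => by
    rw [← heq]; exact h.pairing_add_pos t hz
  have h2 := congrArg (eval r) heq
  simp only [eval_add, eval_mul, eval_C, h1, mul_zero, add_zero, eval_pow, eval_sub, eval_X,
    sub_self, zero_pow (by omega : m ≠ 0)] at h2
  exact hr (h0 r (by simpa using h2))

/-- A greatest root outside `J` is an endpoint. If it is `a`, all roots collapse to `a`, excluded by
`not_pow`; if it is `b`, then `v / u ≤ 0` at `b` and `t ≤ 0` exclude a root there. -/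
lemma exists_isGreatest_mem (h : IsPencil m u v) (hJ : IsHalfOpen J a b) (h0 : 0 ∈ params u v J)
    (hm : 2 ≤ m) {t : ℝ} (ht : t ∈ closure (params u v J)) (ht0 : t ≤ 0) :
    ∃ r ∈ J, IsGreatest {x | (u + C t * v).IsRoot x} r := by
  obtain ⟨r, hr⟩ : ∃ r, IsGreatest {x | (u + C t * v).IsRoot x} r := by
    have hfin : {x | (u + C t * v).IsRoot x}.Finite :=
      finite_setOfPred_isRoot (h.monic_add t).ne_zero
    exact (Set.Finite.isCompact hfin).exists_isGreatest
      (exists_isRoot (h.splits t) (by rw [h.natDegree_add]; omega))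
  refine ⟨r, ?_, hr⟩
  by_contra hrJ
  rcases hJ.eq_or_eq hrJ (h.mem_Icc_of_mem_closure hJ ht hr.1) with rfl | rfl
  · have h1 := eq_pow_of_unique_root (h.splits t) (h.monic_add t) fun x hx =>
      le_antisymm (hr.2 hx) (h.mem_Icc_of_mem_closure hJ ht hx).1
    rw [h.natDegree_add] at h1
    exact h.not_pow h0 hm hrJ h1
  · have h1 := h.ratio_nonpos hJ h0 hrJ le_rfl
    exact eval_ne_zero_of_ratio h1.1 (by nlinarith [h1.2]) hr.1

lemma exists_isLeast_mem (h : IsPencil m u v) (hJ : IsHalfOpen J a b) (h0 : 0 ∈ params u v J)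
    (hm : 2 ≤ m) {t : ℝ} (ht : t ∈ closure (params u v J)) (ht0 : 0 ≤ t) :
    ∃ r ∈ J, IsLeast {x | (u + C t * v).IsRoot x} r := by
  obtain ⟨r, hr⟩ : ∃ r, IsLeast {x | (u + C t * v).IsRoot x} r := by
    have hfin : {x | (u + C t * v).IsRoot x}.Finite :=
      finite_setOfPred_isRoot (h.monic_add t).ne_zero
    exact (Set.Finite.isCompact hfin).exists_isLeast
      (exists_isRoot (h.splits t) (by rw [h.natDegree_add]; omega))
  refine ⟨r, ?_, hr⟩
  by_contra hrJ
  rcases hJ.eq_or_eq hrJ (h.mem_Icc_of_mem_closure hJ ht hr.1) with rfl | rfl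
  · have h1 := h.ratio_nonneg hJ h0 hrJ le_rfl
    exact eval_ne_zero_of_ratio h1.1 (by nlinarith [mul_nonneg ht0 h1.2]) hr.1
  · have h1 := eq_pow_of_unique_root (h.splits t) (h.monic_add t) fun x hx =>
      le_antisymm (h.mem_Icc_of_mem_closure hJ ht hx).2 (hr.2 hx)
    rw [h.natDegree_add] at h1
    exact h.not_pow h0 hm hrJ h1

/-- The extremal members of the pencil. -/
theorem exists_endpoints (h : IsPencil m u v) (hJ : IsHalfOpen J a b) (h0 : 0 ∈ params u v J) :
    ∃ t₁ t₂ : ℝ, t₁ < t₂ ∧ t₁ ≤ 0 ∧ 0 ≤ t₂ ∧ (∀ t ∈ params u v J, t₁ ≤ t ∧ t ≤ t₂) ∧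
      t₁ ∈ closure (params u v J) ∧ t₂ ∈ closure (params u v J) := by
  obtain ⟨K, hK⟩ := h.exists_bound hJ
  have hbb : BddBelow (params u v J) := ⟨-K, fun t ht => (abs_le.1 (hK t ht)).1⟩
  have hba : BddAbove (params u v J) := ⟨K, fun t ht => (abs_le.1 (hK t ht)).2⟩
  obtain ⟨t, ht, htne⟩ := h.exists_params_ne_zero hJ h0
  refine ⟨sInf (params u v J), sSup (params u v J), ?_, csInf_le hbb h0, le_csSup hba h0,
    fun t ht => ⟨csInf_le hbb ht, le_csSup hba ht⟩, csInf_mem_closure ⟨0, h0⟩ hbb,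
    csSup_mem_closure ⟨0, h0⟩ hba⟩
  rcases htne.lt_or_gt with hlt | hlt
  · exact (csInf_le hbb ht).trans_lt (hlt.trans_le (le_csSup hba h0))
  · exact (csInf_le hbb h0).trans_lt (hlt.trans_le (le_csSup hba ht))

end IsPencil

end

/-! ### The dictionary between forms and polynomials of bounded degree. -/

section


/-- Dehomogenization: the polynomial `p(x, 1)`. -/
noncomputable def dehom (n : ℕ) : V n →ₗ[ℂ] ℂ[X] :=
  (MvPolynomial.aeval (![X, 1] : Fin 2 → ℂ[X])).toLinearMap ∘ₗ (V n).subtype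

/-- Homogenization in degree `n`. -/
noncomputable def hom (n : ℕ) : ℂ[X] →ₗ[ℂ] V n :=
  ∑ k : Fin (n + 1), (lcoeff ℂ (k : ℕ)).smulRight (mono n k)

lemma hom_apply (n : ℕ) (P : ℂ[X]) : hom n P = ∑ k : Fin (n + 1), P.coeff k • mono n k := by
  simp [hom, LinearMap.sum_apply]

lemma coe_mono (n : ℕ) (k : Fin (n + 1)) : (mono n k : MvPolynomial (Fin 2) ℂ) =
    MvPolynomial.monomial (Finsupp.single 0 (k : ℕ) + Finsupp.single 1 (n - (k : ℕ))) 1 := by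
  simp only [mono, MvPolynomial.X_pow_eq_monomial, MvPolynomial.monomial_mul, mul_one]

lemma dehom_mono (n : ℕ) (k : Fin (n + 1)) : dehom n (mono n k) = X ^ (k : ℕ) := by
  simp [dehom, mono]

lemma hom_X_pow (n : ℕ) (k : Fin (n + 1)) : hom n (X ^ (k : ℕ)) = mono n k := by
  rw [hom_apply, Finset.sum_eq_single k]
  · simp
  · intro j _ hj
    rw [coeff_X_pow, if_neg (fun h => hj (Fin.ext h)), zero_smul]
  · simp

lemma dehom_hom {n : ℕ} {P : ℂ[X]} (hP : P.natDegree ≤ n) : dehom n (hom n P) = P := by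
  rw [hom_apply, map_sum]
  simp only [map_smul, dehom_mono]
  rw [Fin.sum_univ_eq_sum_range (fun k => P.coeff k • (X ^ k : ℂ[X])) (n + 1)]
  conv_rhs => rw [P.as_sum_range_C_mul_X_pow' (Nat.lt_succ_of_le hP)]
  simp only [smul_eq_C_mul]

/-- In a monomial of degree `n` the exponent of `x` determines that of `y`, so `hom n` reaches every
form. -/
lemma exists_hom_eq {n : ℕ} (p : V n) : ∃ P : ℂ[X], P.natDegree ≤ n ∧ hom n P = p ∧
    (p ∈ VR n → ∀ k, (P.coeff k).im = 0) := by
  have hdeg : ∀ d ∈ (p : MvPolynomial (Fin 2) ℂ).support, d 0 + d 1 = n := by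
    intro d hd
    have h := (MvPolynomial.mem_homogeneousSubmodule n _).1 p.2 (MvPolynomial.mem_support_iff.1 hd)
    rw [← h, Finsupp.weight_apply, Finsupp.sum_fintype _ _ (by simp)]
    simp
  refine ⟨∑ d ∈ (p : MvPolynomial (Fin 2) ℂ).support,
    MvPolynomial.coeff d (p : MvPolynomial (Fin 2) ℂ) • X ^ d 0, ?_, ?_, ?_⟩
  · refine natDegree_sum_le_of_forall_le _ _ fun d hd => (natDegree_smul_le _ _).trans ?_
    rw [natDegree_X_pow]
    have := hdeg d hd
    omega
  · apply Subtype.ext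
    rw [map_sum, AddSubmonoidClass.coe_finsetSum]
    conv_rhs => rw [(p : MvPolynomial (Fin 2) ℂ).as_sum]
    refine Finset.sum_congr rfl fun d hd => ?_
    have h := hdeg d hd
    have h1 : hom n (X ^ d 0) = mono n ⟨d 0, by omega⟩ := hom_X_pow n ⟨d 0, by omega⟩
    rw [map_smul, h1, Submodule.coe_smul, MvPolynomial.monomial_eq, Finsupp.prod_fintype _ _
      (by simp), MvPolynomial.smul_eq_C_mul]
    simp only [mono, Fin.prod_univ_two]
    rw [show n - d 0 = d 1 by omega]
  · intro hp k
    rw [finsetSum_coeff, Complex.im_sum]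
    refine Finset.sum_eq_zero fun d _ => ?_
    rw [coeff_smul, coeff_X_pow, smul_eq_mul]
    split_ifs
    · rw [mul_one]; exact hp d
    · simp

lemma hom_dehom {n : ℕ} (p : V n) : hom n (dehom n p) = p := by
  obtain ⟨P, hP, rfl, _⟩ := exists_hom_eq p
  rw [dehom_hom hP]

lemma natDegree_dehom_le {n : ℕ} (p : V n) : (dehom n p).natDegree ≤ n := by
  obtain ⟨P, hP, rfl, _⟩ := exists_hom_eq p
  rwa [dehom_hom hP]

lemma dehom_injective (n : ℕ) : Function.Injective (dehom n) :=
  Function.LeftInverse.injective (g := hom n) hom_dehom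

lemma hom_toC_mem_VR (n : ℕ) (P : ℝ[X]) : hom n (toC P) ∈ VR n := by
  rw [hom_apply]
  refine Submodule.sum_mem _ fun k _ => ?_
  have h1 : (toC P).coeff k • mono n k = P.coeff k • mono n k := by
    rw [coeff_map]
    exact algebraMap_smul ℂ (P.coeff k) (mono n k)
  rw [h1]
  refine Submodule.smul_mem _ _ fun d => ?_
  rw [coe_mono, MvPolynomial.coeff_monomial]
  split_ifs <;> simp

lemma mem_VR_iff {n : ℕ} (p : V n) : p ∈ VR n ↔ ∃ P : ℝ[X], dehom n p = toC P := by
  constructor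
  · intro hp
    obtain ⟨P, hP, rfl, hre⟩ := exists_hom_eq p
    refine ⟨rePart P, ?_⟩
    rw [dehom_hom hP]
    ext k
    rw [coeff_map, coeff_rePart]
    exact Complex.ext (by simp) (by simp [hre hp k])
  · rintro ⟨P, hP⟩
    rw [← hom_dehom p, hP]
    exact hom_toC_mem_VR n P

lemma eval_coords {n : ℕ} (p : V n) (Q : OnePoint ℂ) :
    MvPolynomial.eval (coords Q) (p : MvPolynomial (Fin 2) ℂ) = evalAt n Q (dehom n p) := by
  have key : ∀ k : Fin (n + 1), MvPolynomial.eval (coords Q)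
      (mono n k : MvPolynomial (Fin 2) ℂ) = evalAt n Q (X ^ (k : ℕ)) := by
    intro k
    induction Q using OnePoint.rec with
    | infty =>
      rw [evalAt_infty, coeff_X_pow]
      by_cases h : n = k
      · simp [mono, coords, h]
      · have : n - (k : ℕ) ≠ 0 := by have := k.isLt; omega
        simp [mono, coords, h, this]
    | coe z => simp [mono, coords]
  conv_lhs => rw [← hom_dehom p, hom_apply]
  conv_rhs => rw [← hom_dehom p, hom_apply]
  rw [AddSubmonoidClass.coe_finsetSum, map_sum, map_sum, map_sum]
  refine Finset.sum_congr rfl fun k _ => ?_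
  rw [Submodule.coe_smul, MvPolynomial.smul_eval, key, map_smul, dehom_mono, map_smul, smul_eq_mul]

lemma isRoot_iff {n : ℕ} (p : V n) (Q : OnePoint ℂ) :
    IsRoot p Q ↔ evalAt n Q (dehom n p) = 0 := by
  rw [IsRoot, eval_coords]

lemma isTopMonic_iff {n : ℕ} (p : V n) : IsTopMonic p ↔ (dehom n p).coeff n = 1 := by
  have key : ∀ k : Fin (n + 1), MvPolynomial.coeff (Finsupp.single 0 n)
      (mono n k : MvPolynomial (Fin 2) ℂ) = (X ^ (k : ℕ) : ℂ[X]).coeff n := by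
    intro k
    rw [coe_mono, MvPolynomial.coeff_monomial, coeff_X_pow]
    refine if_congr ⟨fun h => ?_, fun h => ?_⟩ rfl rfl
    · have := DFunLike.congr_fun h 0
      simpa using this.symm
    · rw [← h]; simp
  rw [IsTopMonic]
  refine iff_of_eq (congrArg (· = 1) ?_)
  conv_lhs => rw [← hom_dehom p, hom_apply]
  conv_rhs => rw [← hom_dehom p, hom_apply]
  rw [AddSubmonoidClass.coe_finsetSum, MvPolynomial.coeff_sum, map_sum, finsetSum_coeff]
  refine Finset.sum_congr rfl fun k _ => ?_
  rw [Submodule.coe_smul, MvPolynomial.coeff_smul, key, map_smul, dehom_mono, coeff_smul]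

/-- The operator on polynomials that corresponds to an operator on forms. -/
noncomputable def cplxOp {n m : ℕ} (T : V n →ₗ[ℂ] V m) : ℂ[X] →ₗ[ℂ] ℂ[X] :=
  dehom m ∘ₗ T ∘ₗ hom n

/-- The operator on real polynomials that corresponds to a real operator on forms. -/
noncomputable def realOp {n m : ℕ} (T : V n →ₗ[ℂ] V m) : ℝ[X] →ₗ[ℝ] ℝ[X] where
  toFun P := rePart (cplxOp T (toC P))
  map_add' P Q := by rw [toC, Polynomial.map_add, map_add, map_add]
  map_smul' c P := by
    have h : cplxOp T (toC (c • P)) = c • cplxOp T (toC P) := by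
      rw [toC, Polynomial.map_smul, map_smul]
      exact algebraMap_smul ℂ c _
    rw [h, map_smul]
    rfl

variable {n m : ℕ} {T : V n →ₗ[ℂ] V m}

lemma dehom_apply (T : V n →ₗ[ℂ] V m) (p : V n) : dehom m (T p) = cplxOp T (dehom n p) := by
  rw [cplxOp, LinearMap.comp_apply, LinearMap.comp_apply, hom_dehom]

lemma isComplexification (hT : IsRealOperator T) :
    IsComplexification m (realOp T) (cplxOp T) where
  map_toC P := by
    obtain ⟨Q, hQ⟩ := (mem_VR_iff _).1 (hT _ (hom_toC_mem_VR n P))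
    have h1 : cplxOp T (toC P) = toC Q := hQ
    change _ = toC (rePart (cplxOp T (toC P)))
    rw [h1, rePart_toC]
  natDegree_le P := (natDegree_rePart_le _).trans (natDegree_dehom_le _)

/-- The binomial theorem, a finite first point having second coordinate `w = 1`. The point `∞` is
not needed there, as it is not in `lowerH ∪ realSet I`. -/
lemma eval_symb (T : V n →ₗ[ℂ] V m) (z : ℂ) (Q : OnePoint ℂ) :
    MvPolynomial.eval (Sum.elim (coords z) (coords Q)) (symb T) =
      evalAt m Q (cplxOp T ((C z - X) ^ n)) := by
  have h1 : ((C z - X) ^ n : ℂ[X]) = ∑ k : Fin (n + 1),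
      ((n.choose k : ℂ) * z ^ (n - (k : ℕ)) * (-1) ^ (k : ℕ)) • (X ^ (k : ℕ) : ℂ[X]) := by
    rw [Fin.sum_univ_eq_sum_range (fun k => ((n.choose k : ℂ) * z ^ (n - k) * (-1) ^ k) •
      (X ^ k : ℂ[X])) (n + 1), sub_eq_neg_add, add_pow]
    refine Finset.sum_congr rfl fun k _ => ?_
    rw [smul_eq_C_mul, neg_pow, C_mul, C_mul, C_pow, C_pow, C_neg, C_1, C_eq_natCast]
    ring
  rw [h1, map_sum, map_sum, symb, map_sum]
  refine Finset.sum_congr rfl fun k _ => ?_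
  have h2 : cplxOp T (X ^ (k : ℕ)) = dehom m (T (mono n k)) := by
    rw [cplxOp, LinearMap.comp_apply, LinearMap.comp_apply, hom_X_pow]
  rw [map_smul, map_smul, h2, ← eval_coords, smul_eq_mul, map_mul, MvPolynomial.eval_rename,
    Sum.elim_comp_inr]
  congr 1
  simp [coords]

/-- A real polynomial of degree exactly `m` all of whose complex roots lie in the set `J` of real
numbers. -/
structure RootedAt (m : ℕ) (J : Set ℝ) (P : ℝ[X]) : Prop where
  coeff_ne_zero : P.coeff m ≠ 0
  splits : P.Splits
  mem_of_isRoot : ∀ x, P.IsRoot x → x ∈ J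

lemma coe_mem_realSet {S : Set ℝ} {z : ℂ} : (z : OnePoint ℂ) ∈ realSet S ↔ z.im = 0 ∧ z.re ∈ S := by
  constructor
  · rintro ⟨t, ht, h⟩
    rw [← OnePoint.coe_injective h]
    simpa using ht
  · rintro ⟨h0, h1⟩
    exact ⟨z.re, h1, congrArg _ (Complex.ext (by simp) (by simp [h0]))⟩

lemma infty_notMem_realSet {S : Set ℝ} : OnePoint.infty ∉ realSet S := by
  rintro ⟨t, _, h⟩
  exact OnePoint.coe_ne_infty _ h

lemma rootedAt_iff {P : ℝ[X]} {J : Set ℝ} :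
    RootedAt m J P ↔ ∀ Q, evalAt m Q (toC P) = 0 → Q ∈ realSet J := by
  constructor
  · intro h Q hQ
    have hP0 : P ≠ 0 := by rintro rfl; exact h.coeff_ne_zero (by simp)
    induction Q using OnePoint.rec with
    | infty => exact absurd (by simpa using hQ) h.coeff_ne_zero
    | coe z =>
      rw [evalAt_coe] at hQ
      have hz : z.im = 0 := by
        by_contra hz
        exact eval_toC_ne_zero h.splits hP0 hz hQ
      have hzr : z = (z.re : ℂ) := Complex.ext (by simp) (by simp [hz])
      rw [coe_mem_realSet]
      refine ⟨hz, h.mem_of_isRoot _ ?_⟩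
      rw [hzr, eval_toC_ofReal] at hQ
      exact_mod_cast hQ
  · intro h
    refine ⟨fun h0 => infty_notMem_realSet (h OnePoint.infty (by simp [h0])),
      splits_of_upper fun z hz h0 => hz.ne' (coe_mem_realSet.1 (h z h0)).1, fun x hx => ?_⟩
    have h1 := coe_mem_realSet.1 (h (x : ℂ) (by rw [evalAt_coe, eval_toC_ofReal, hx.eq_zero]; simp))
    simpa using h1.2

lemma isRootedIn_realSet_iff {q : V m} {P : ℝ[X]} (hq : dehom m q = toC P) {J : Set ℝ} :
    IsRootedIn (realSet J) q ↔ RootedAt m J P := by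
  simp only [IsRootedIn, isRoot_iff, hq, rootedAt_iff]

lemma infty_mem_closure {S : Set ℂ} {w : ℂ} (hw : w ≠ 0) (h : ∀ k : ℕ, ((k : ℂ) + 1) * w ∈ S) :
    OnePoint.infty ∈ closure ((fun z : ℂ => (z : OnePoint ℂ)) '' S) := by
  have h1 : Tendsto (fun k : ℕ => ((k : ℂ) + 1) * w) atTop (coclosedCompact ℂ) := by
    rw [coclosedCompact_eq_cocompact, ← Metric.cobounded_eq_cocompact, ← comap_norm_atTop,
      tendsto_comap_iff]
    have h2 : ∀ k : ℕ, ‖((k : ℂ) + 1) * w‖ = ((k : ℝ) + 1) * ‖w‖ := fun k => by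
      rw [norm_mul]
      congr 1
      exact_mod_cast Complex.norm_natCast (k + 1)
    simp only [Function.comp_def, h2]
    exact (tendsto_atTop_add_const_right _ _ tendsto_natCast_atTop_atTop).atTop_mul_const
      (norm_pos_iff.2 hw)
  exact mem_closure_of_tendsto (OnePoint.tendsto_coe_infty.comp h1)
    (Eventually.of_forall fun k => ⟨_, h k, rfl⟩)

lemma coe_mem_closure {S : Set ℂ} {z : ℂ} :
    (z : OnePoint ℂ) ∈ closure ((fun z : ℂ => (z : OnePoint ℂ)) '' S) ↔ z ∈ closure S := by
  rw [OnePoint.isOpenEmbedding_coe.isInducing.closure_eq_preimage_closure_image S]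
  rfl

lemma coe_mem_closure_upperH {z : ℂ} : (z : OnePoint ℂ) ∈ closure upperH ↔ 0 ≤ z.im := by
  rw [upperH, coe_mem_closure, Complex.closure_setOfPred_lt_im]
  rfl

lemma coe_mem_closure_lowerH {z : ℂ} : (z : OnePoint ℂ) ∈ closure lowerH ↔ z.im ≤ 0 := by
  rw [lowerH, coe_mem_closure, Complex.closure_setOfPred_im_lt]
  rfl

lemma infty_mem_closure_upperH : OnePoint.infty ∈ closure upperH :=
  infty_mem_closure (w := Complex.I) (by simp) fun k => by
    simp
    positivity

lemma infty_mem_closure_lowerH : OnePoint.infty ∈ closure lowerH :=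
  infty_mem_closure (w := -Complex.I) (by simp) fun k => by
    have := k.cast_nonneg (α := ℝ)
    simp
    linarith

lemma realSet_univ : realSet Set.univ = (fun z : ℂ => (z : OnePoint ℂ)) '' {z : ℂ | z.im = 0} := by
  ext Q
  induction Q using OnePoint.rec with
  | infty => simp [infty_notMem_realSet]
  | coe z =>
    rw [coe_mem_realSet, OnePoint.coe_injective.mem_set_image]
    simp

lemma coe_mem_closure_real {z : ℂ} : (z : OnePoint ℂ) ∈ closure (realSet Set.univ) ↔ z.im = 0 := by
  rw [realSet_univ, coe_mem_closure,
    (isClosed_eq Complex.continuous_im continuous_const).closure_eq]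
  rfl

lemma infty_mem_closure_real : OnePoint.infty ∈ closure (realSet Set.univ) := by
  rw [realSet_univ]
  exact infty_mem_closure one_ne_zero fun k => by simp

/-- The zero polynomial splits but the zero form is not real-rooted, hence `hP`. Accordingly
`Splits` encodes "real-rooted or zero" in the statements on operators. -/
lemma isRealRooted_iff {q : V m} {P : ℝ[X]} (hq : dehom m q = toC P) (hP : P ≠ 0) :
    IsRealRooted q ↔ P.Splits := by
  simp only [IsRealRooted, IsRootedIn, isRoot_iff, hq]
  constructor
  · exact fun h => splits_of_upper fun z hz h0 => hz.ne' (coe_mem_closure_real.1 (h z h0))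
  · intro h Q hQ
    induction Q using OnePoint.rec with
    | infty => exact infty_mem_closure_real
    | coe z =>
      rw [coe_mem_closure_real]
      by_contra hz
      exact eval_toC_ne_zero h hP hz hQ

lemma dehom_eq_zero_iff {q : V m} : dehom m q = 0 ↔ q = 0 :=
  map_eq_zero_iff _ (dehom_injective m)

lemma preservesWeakRealRootedness_iff (hT : IsRealOperator T) :
    PreservesWeakRealRootedness T ↔
      ∀ P : ℝ[X], P.natDegree ≤ n → P.Splits → (realOp T P).Splits := by
  have hAB := isComplexification hT
  constructor
  · intro h P hdeg hP
    by_cases hP0 : P = 0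
    · rw [hP0, map_zero]; exact Splits.zero
    by_cases hA0 : realOp T P = 0
    · rw [hA0]; exact Splits.zero
    have hp : dehom n (hom n (toC P)) = toC P := dehom_hom (natDegree_map_le.trans hdeg)
    have hTp : dehom m (T (hom n (toC P))) = toC (realOp T P) := hAB.map_toC P
    rcases h _ ((mem_VR_iff _).2 ⟨P, hp⟩) ((isRealRooted_iff hp hP0).2 hP) with h1 | h1
    · rw [h1, map_zero] at hTp
      exact absurd ((Polynomial.map_eq_zero _).1 hTp.symm) hA0
    · exact (isRealRooted_iff hTp hA0).1 h1
  · intro h p hp hpr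
    obtain ⟨P, hP⟩ := (mem_VR_iff p).1 hp
    have hTp : dehom m (T p) = toC (realOp T P) := by rw [dehom_apply, hP, hAB.map_toC]
    by_cases hA0 : realOp T P = 0
    · left
      rw [← dehom_eq_zero_iff, hTp, hA0, toC, Polynomial.map_zero]
    · right
      have hP0 : P ≠ 0 := by rintro rfl; exact hA0 (map_zero _)
      refine (isRealRooted_iff hTp hA0).2 (h P ?_ ((isRealRooted_iff hP hP0).1 hpr))
      have h1 := natDegree_dehom_le p
      rwa [hP, natDegree_map] at h1

lemma isStableOn_symb_iff {I : Set ℝ} {S : Set (OnePoint ℂ)} :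
    IsStableOn (lowerH ∪ realSet I) S (symb T) ↔
      ∀ z ∈ lowerUnion I, ∀ Q ∈ S, evalAt m Q (cplxOp T ((C z - X) ^ n)) ≠ 0 := by
  have hmem : ∀ z : ℂ, (z : OnePoint ℂ) ∈ lowerH ∪ realSet I ↔ z ∈ lowerUnion I := by
    intro z
    rw [Set.mem_union, coe_mem_realSet, lowerH, OnePoint.coe_injective.mem_set_image]
    rfl
  constructor
  · intro h z hz Q hQ
    rw [← eval_symb]
    exact h z ((hmem z).2 hz) Q hQ
  · intro h P hP Q hQ
    induction P using OnePoint.rec with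
    | infty =>
      rcases hP with ⟨_, _, h0⟩ | h0
      · exact absurd h0 (OnePoint.coe_ne_infty _)
      · exact absurd h0 infty_notMem_realSet
    | coe z =>
      rw [eval_symb]
      exact h z ((hmem z).1 hP) Q hQ

end

/-! ### The boundary of the half-planes, and from stability to `J`-rootedness. -/

section


variable {n m : ℕ} {T : V n →ₗ[ℂ] V m} {I J : Set ℝ} {a b : ℝ}
  {A : ℝ[X] →ₗ[ℝ] ℝ[X]} {B : ℂ[X] →ₗ[ℂ] ℂ[X]}

/-- `A` maps `I`-rooted polynomials of degree `n` to `J`-rooted polynomials of degree `m`. -/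
def MapsRooted (n m : ℕ) (I J : Set ℝ) (A : ℝ[X] →ₗ[ℝ] ℝ[X]) : Prop :=
  ∀ P : ℝ[X], P.natDegree ≤ n → RootedAt n I P → RootedAt m J (A P)

/-- All roots are real and finite, so dividing by the leading coefficient leaves a real polynomial;
complex `I`-rooted forms reduce to real ones. -/
lemma exists_real_of_isRootedIn {p : V n} (hp : IsRootedIn (realSet I) p) :
    ∃ (c : ℂ) (P : ℝ[X]), c ≠ 0 ∧ P.natDegree ≤ n ∧ RootedAt n I P ∧ dehom n p = c • toC P := by
  set H := dehom n p with hH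
  have hroot : ∀ Q, evalAt n Q H = 0 → Q ∈ realSet I := fun Q hQ => hp Q ((isRoot_iff p Q).2 hQ)
  have hcoeff : H.coeff n ≠ 0 := fun h0 =>
    infty_notMem_realSet (hroot OnePoint.infty h0)
  have hH0 : H ≠ 0 := by intro h; simp [h] at hcoeff
  have hreal : ∀ r ∈ H.roots, r.im = 0 := fun r hr =>
    (coe_mem_realSet.1 (hroot r (mem_roots'.1 hr).2)).1
  set P : ℝ[X] := ((H.roots.map Complex.re).map (fun x => X - C x)).prod with hP
  have hHP : H = H.leadingCoeff • toC P := by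
    conv_lhs => rw [(IsAlgClosed.splits H).eq_prod_roots]
    rw [smul_eq_C_mul, hP, toC, Polynomial.map_multiset_prod, Multiset.map_map, Multiset.map_map]
    congr 2
    refine Multiset.map_congr rfl fun r hr => ?_
    have : (r.re : ℂ) = r := Complex.ext (by simp) (by simp [hreal r hr])
    simp [this]
  have hlc : H.leadingCoeff ≠ 0 := leadingCoeff_ne_zero.2 hH0
  refine ⟨H.leadingCoeff, P, hlc, ?_, ?_, hHP⟩
  · rw [hP, natDegree_multiset_prod_X_sub_C_eq_card, Multiset.card_map]
    exact (card_roots' H).trans (natDegree_dehom_le p)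
  · rw [rootedAt_iff]
    intro Q hQ
    refine hroot Q ?_
    rw [hHP, map_smul, hQ, smul_zero]

lemma mapsRooted_iff (hT : IsRealOperator T) :
    (∀ p : V n, IsRootedIn (realSet I) p → T p ≠ 0 ∧ IsRootedIn (realSet J) (T p)) ↔
      MapsRooted n m I J (realOp T) := by
  have hAB := isComplexification hT
  constructor
  · intro h P hdeg hP
    have hp : dehom n (hom n (toC P)) = toC P := dehom_hom (natDegree_map_le.trans hdeg)
    have hTp : dehom m (T (hom n (toC P))) = toC (realOp T P) := hAB.map_toC P
    exact (isRootedIn_realSet_iff hTp).1 (h _ ((isRootedIn_realSet_iff hp).2 hP)).2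
  · intro h p hp
    obtain ⟨c, P, hc, hdeg, hP, hpP⟩ := exists_real_of_isRootedIn hp
    have hA := h P hdeg hP
    have hTp : dehom m (T p) = c • toC (realOp T P) := by
      rw [dehom_apply, hpP, map_smul, hAB.map_toC]
    refine ⟨fun h0 => ?_, fun Q hQ => ?_⟩
    · rw [h0, map_zero, eq_comm, smul_eq_zero, or_iff_right hc] at hTp
      have h1 := hA.coeff_ne_zero
      rw [(Polynomial.map_eq_zero _).1 hTp] at h1
      simp at h1
    · rw [isRoot_iff, hTp, map_smul, smul_eq_zero, or_iff_right hc] at hQ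
      exact rootedAt_iff.1 hA Q hQ

lemma rootedAt_pow {t : ℝ} (ht : t ∈ I) : RootedAt n I ((C t - X) ^ n) := by
  refine ⟨?_, ?_, fun x hx => ?_⟩
  · rw [← neg_sub, neg_pow, show ((-1 : ℝ[X]) ^ n) = C ((-1) ^ n) by simp, coeff_C_mul]
    have h1 := ((monic_X_sub_C t).pow n).coeff_natDegree
    rw [natDegree_pow, natDegree_X_sub_C, mul_one] at h1
    rw [h1]
    simp
  · rw [← neg_sub]
    exact (Splits.X_sub_C t).neg.pow n
  · rw [IsRoot.def, eval_pow, eval_sub, eval_C, eval_X] at hx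
    rw [← sub_eq_zero.1 (eq_zero_of_pow_eq_zero hx)]
    exact ht

lemma natDegree_C_sub_X_pow_le {R : Type*} [CommRing R] (t : R) :
    ((C t - X) ^ n : R[X]).natDegree ≤ n := by
  refine natDegree_pow_le.trans ?_
  have : (C t - X : R[X]).natDegree ≤ 1 :=
    (natDegree_sub_le _ _).trans (by simpa using natDegree_X_le)
  simpa using Nat.mul_le_mul_left n this

/-- Stability of the symbol for the rest of the closure. -/
lemma stable_of_stable_halfPlane (hAB : IsComplexification m A B) (hI' : I.Nonempty)
    (hR : MapsRooted n m I J A) {σ : ℝ} (hσ : σ ≠ 0)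
    (hst : ∀ z : ℂ, z.im < 0 → ∀ x : ℂ, 0 < σ * x.im → (B ((C z - X) ^ n)).eval x ≠ 0)
    {Q : OnePoint ℂ} (hQJ : Q ∉ realSet J) (hQ : ∀ w : ℂ, Q = w → 0 ≤ σ * w.im) {z : ℂ}
    (hz : z ∈ lowerUnion I) : evalAt m Q (B ((C z - X) ^ n)) ≠ 0 := by
  -- The image of the `I`-rooted `(t - X) ^ n` is `J`-rooted. This also shows that the limit
  -- polynomial in `z` at a boundary point is not identically zero.
  have hreal : ∀ t ∈ I, evalAt m Q (B ((C (t : ℂ) - X) ^ n)) ≠ 0 := by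
    intro t ht h0
    have h1 := hR _ (natDegree_C_sub_X_pow_le t) (rootedAt_pow ht)
    refine hQJ (rootedAt_iff.1 h1 Q ?_)
    rw [← hAB.map_toC, ← h0]
    simp [toC]
  obtain ⟨t, ht⟩ := hI'
  rcases hz with hz | ⟨hz0, hzI⟩
  · have hσ2 : 0 < σ * σ := mul_self_pos.2 hσ
    induction Q using OnePoint.rec with
    | infty =>
      -- The point `∞` is approached along `x = i / (σε)`, inside the half-plane selected by `σ`;
      -- division by `x ^ m` yields the coefficient of degree `m`.
      have hl : Tendsto (fun ε : ℝ => -(σ : ℂ) * Complex.I * ε) (𝓝[>] 0) (𝓝 0) := by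
        have h1 : Continuous fun ε : ℝ => -(σ : ℂ) * Complex.I * ε := by fun_prop
        have h2 := h1.tendsto 0
        rw [Complex.ofReal_zero, mul_zero] at h2
        exact h2.mono_left nhdsWithin_le_nhds
      have hne : ∀ ε : ℝ, 0 < ε → -(σ : ℂ) * Complex.I * ε ≠ 0 := fun ε hε => by
        simp [hσ, hε.ne']
      refine evalAt_ne_zero_of_limit (U := {x | 0 < σ * x.im})
        (l := map (fun ε : ℝ => (-(σ : ℂ) * Complex.I * ε)⁻¹) (𝓝[>] 0))
        (c := fun x => x⁻¹ ^ m) hst ?_ ?_ (hreal t ht) hz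
      · rw [eventually_map]
        filter_upwards [self_mem_nhdsWithin] with ε hε
        have hε : 0 < ε := hε
        refine ⟨?_, pow_ne_zero _ (inv_ne_zero (inv_ne_zero (hne ε hε)))⟩
        rw [Complex.inv_im]
        have h1 : 0 < Complex.normSq (-(σ : ℂ) * Complex.I * ε) :=
          Complex.normSq_pos.2 (hne ε hε)
        have h2 : -(-(σ : ℂ) * Complex.I * ε).im = σ * ε := by simp
        rw [h2, ← mul_div_assoc, ← mul_assoc]
        exact div_pos (mul_pos hσ2 hε) h1
      · intro P
        rw [tendsto_map'_iff]
        simp only [Function.comp_def, inv_inv]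
        exact tendsto_coeff (hAB.natDegree_apply_le P) hl
          (by filter_upwards [self_mem_nhdsWithin] with ε hε using hne ε hε)
    | coe w =>
      rcases (hQ w rfl).lt_or_eq with hpos | hzero
      · exact hst z hz w hpos
      · have hl : Tendsto (fun ε : ℝ => w + (σ : ℂ) * Complex.I * ε) (𝓝[>] 0) (𝓝 w) := by
          have h1 : Continuous fun ε : ℝ => w + (σ : ℂ) * Complex.I * ε := by fun_prop
          have h2 := h1.tendsto 0
          rw [Complex.ofReal_zero, mul_zero, add_zero] at h2
          exact h2.mono_left nhdsWithin_le_nhds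
        refine evalAt_ne_zero_of_limit (U := {x | 0 < σ * x.im})
          (l := map (fun ε : ℝ => w + (σ : ℂ) * Complex.I * ε) (𝓝[>] 0))
          (c := fun _ => 1) hst ?_ ?_ (hreal t ht) hz
        · rw [eventually_map]
          filter_upwards [self_mem_nhdsWithin] with ε hε
          have hε : 0 < ε := hε
          refine ⟨?_, one_ne_zero⟩
          have h2 : (w + (σ : ℂ) * Complex.I * ε).im = w.im + σ * ε := by simp
          rw [h2, mul_add, ← hzero, zero_add, ← mul_assoc]
          exact mul_pos hσ2 hε
        · intro P
          rw [tendsto_map'_iff]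
          simp only [Function.comp_def, one_mul]
          exact ((B P).continuous.tendsto w).comp hl
  · have hzr : z = (z.re : ℂ) := Complex.ext (by simp) (by simp [hz0])
    rw [hzr]
    exact hreal _ hzI

/-- Stability of the symbol implies the mapping properties. -/
lemma mapsRooted_of_stable (hAB : IsComplexification m A B) (hI : I.OrdConnected)
    (hI' : I.Nonempty) {S : Set (OnePoint ℂ)} (hS : OnePoint.infty ∈ S)
    (hSc : ∀ w : ℂ, (w : OnePoint ℂ) ∈ S ∨ ((conj w : ℂ) : OnePoint ℂ) ∈ S)
    (hst : ∀ z ∈ lowerUnion I, ∀ Q ∈ S \ realSet J, evalAt m Q (B ((C z - X) ^ n)) ≠ 0) :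
    MapsRooted n m I J A := by
  intro P hdeg hP
  have hP0 : P ≠ 0 := by rintro rfl; exact hP.coeff_ne_zero (by simp)
  have hdeg' : P.natDegree = n := le_antisymm hdeg (le_natDegree_of_ne_zero hP.coeff_ne_zero)
  -- An `I`-rooted polynomial has exactly `n` roots, all in `I`, so Grace–Walsh applies with the
  -- functional "value of `B` at `Q`".
  have key : ∀ Q ∈ S \ realSet J, evalAt m Q (toC (A P)) ≠ 0 := by
    intro Q hQ
    have hcard : (P.roots.map (fun x : ℝ => (x : ℂ))).card = n := by
      rw [Multiset.card_map, ← hP.splits.natDegree_eq_card_roots, hdeg']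
    have h1 := grace_lowerUnion hI hI' (P.roots.map (fun x : ℝ => (x : ℂ))) (fun z hz => by
      obtain ⟨x, hx, rfl⟩ := Multiset.mem_map.1 hz
      exact Or.inr ⟨by simp, by simpa using hP.mem_of_isRoot x (mem_roots'.1 hx).2⟩)
      (evalAt m Q ∘ₗ B) (fun z hz => by rw [hcard]; exact hst z hz Q hQ)
    have h2 : toC P = ((P.leadingCoeff : ℂ) * (-1) ^ P.roots.card) •
        ((P.roots.map (fun x : ℝ => (x : ℂ))).map (fun z => C z - X)).prod := by
      conv_lhs => rw [hP.splits.eq_prod_roots]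
      rw [smul_eq_C_mul, toC, Polynomial.map_mul, Polynomial.map_multiset_prod, Multiset.map_map,
        Multiset.map_map, map_C, C_mul, mul_assoc]
      congr 1
      rw [C_pow, C_neg, C_1, ← Multiset.card_map ((fun z => C z - X) ∘ fun x : ℝ => (x : ℂ)),
        ← Multiset.prod_map_neg, Multiset.map_map]
      congr 1
      refine Multiset.map_congr rfl fun x _ => ?_
      simp
    rw [← hAB.map_toC, h2, map_smul, map_smul]
    refine smul_ne_zero (mul_ne_zero ?_ (pow_ne_zero _ (neg_ne_zero.2 one_ne_zero))) h1
    exact_mod_cast leadingCoeff_ne_zero.2 hP0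
  rw [rootedAt_iff]
  intro Q hQ0
  by_contra hQ
  induction Q using OnePoint.rec with
  | infty => exact key _ ⟨hS, hQ⟩ hQ0
  | coe w =>
    rcases hSc w with h | h
    · exact key _ ⟨h, hQ⟩ hQ0
    · refine key _ ⟨h, fun h1 => hQ ?_⟩ ?_
      · rw [coe_mem_realSet] at h1 ⊢
        simpa using h1
      · rw [evalAt_coe] at hQ0 ⊢
        rw [eval_toC_conj, hQ0, map_zero]

end

/-! ### The degenerate condition implies the mapping properties. -/

section


variable {n m : ℕ} {T : V n →ₗ[ℂ] V m} {I J : Set ℝ} {a b : ℝ}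

lemma rootedAt_closure_iff (hJ : IsHalfOpen J a b) {P : ℝ[X]} :
    RootedAt m (closure J) P ↔ P.coeff m ≠ 0 ∧ P.Splits ∧ ∀ x, P.IsRoot x → x ∈ Set.Icc a b := by
  rw [hJ.closure_eq]
  exact ⟨fun h => ⟨h.1, h.2, h.3⟩, fun h => ⟨h.1, h.2.1, h.2.2⟩⟩

lemma realRoots_eq {q : V m} {P : ℝ[X]} (hq : dehom m q = toC P) :
    realRoots q = {x | P.IsRoot x} := by
  ext x
  change IsRoot q _ ↔ P.IsRoot x
  rw [isRoot_iff, hq, evalAt_coe, eval_toC_ofReal, Complex.ofReal_eq_zero, IsRoot.def]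

lemma dehom_real_smul (r : ℝ) (q : V m) : dehom m (r • q) = C (r : ℂ) * dehom m q := by
  rw [LinearMap.map_smul_of_tower, ← algebraMap_smul ℂ r (dehom m q), smul_eq_C_mul]
  rfl

/-- The real polynomial that corresponds to a real form. -/
noncomputable def realPoly (n : ℕ) : VR n →ₗ[ℝ] ℝ[X] where
  toFun p := rePart (dehom n (p : V n))
  map_add' p q := by rw [Submodule.coe_add, map_add, map_add]
  map_smul' r p := by
    rw [Submodule.coe_smul, LinearMap.map_smul_of_tower, map_smul]
    rfl

lemma toC_realPoly (p : VR n) : toC (realPoly n p) = dehom n (p : V n) := by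
  obtain ⟨P, hP⟩ := (mem_VR_iff _).1 p.2
  change toC (rePart (dehom n (p : V n))) = _
  rw [hP, rePart_toC]

lemma natDegree_realPoly_le (p : VR n) : (realPoly n p).natDegree ≤ n :=
  (natDegree_rePart_le _).trans (natDegree_dehom_le _)

lemma dehom_apply_real (hT : IsRealOperator T) (p : VR n) :
    dehom m (T (p : V n)) = toC (realOp T (realPoly n p)) := by
  rw [dehom_apply, ← toC_realPoly, (isComplexification hT).map_toC]

/-- Linear combinations of forms in proper position are real-rooted. -/
lemma splits_combination_of_properPosition {q₁ q₂ : V m} {P₁ P₂ : ℝ[X]}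
    (h₁ : dehom m q₁ = toC P₁) (h₂ : dehom m q₂ = toC P₂) (hmon : P₂ ≠ 0)
    (h : ProperPosition q₁ q₂) (α β : ℝ) : (C α * P₁ + C β * P₂).Splits := by
  have hd : dehom m (q₂ + Complex.I • q₁) = toC P₂ + C Complex.I * toC P₁ := by
    rw [map_add, map_smul, h₁, h₂, smul_eq_C_mul]
  have hst : ∀ z : ℂ, 0 < z.im → (toC P₂ + C Complex.I * toC P₁).eval z ≠ 0 := by
    intro z hz h0
    rcases h with h | h
    · rw [h, map_zero] at hd
      apply hmon
      have h1 := congrArg rePart hd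
      rw [map_zero] at h1
      ext k
      have h2 := congrArg (fun Q => coeff Q k) h1
      simp only [coeff_rePart, coeff_add, coeff_C_mul, coeff_map] at h2
      simpa using h2.symm
    · refine h (z : OnePoint ℂ) ⟨z, hz, rfl⟩ ?_
      rw [isRoot_iff, hd]
      exact h0
  by_cases h0 : α = 0 ∧ β = 0
  · simp [h0.1, h0.2]
  have h1 : C α * P₁ + C β * P₂ =
      rePart (C ((β : ℂ) - Complex.I * α) * (toC P₂ + C Complex.I * toC P₁)) := by
    ext k
    rw [coeff_rePart, coeff_C_mul, coeff_add, coeff_C_mul, coeff_add, coeff_C_mul, coeff_C_mul,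
      coeff_map, coeff_map]
    simp
    ring
  rw [h1]
  refine splits_rePart_of_stable fun z hz => ?_
  rw [eval_mul, eval_C]
  refine mul_ne_zero (fun h => h0 ?_) (hst z hz)
  have h2 := congrArg Complex.re h
  have h3 := congrArg Complex.im h
  simp at h2 h3
  exact ⟨h3, h2⟩

lemma imageDim_le_one {q : V m} (h : ∀ p : V n, ∃ c : ℂ, T p = c • q) : imageDim T ≤ 1 := by
  have hle : LinearMap.range T ≤ Submodule.span ℂ ({q} : Set (V m)) := by
    rintro _ ⟨p, rfl⟩
    obtain ⟨c, hc⟩ := h p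
    rw [hc]
    exact Submodule.smul_mem _ _ (Submodule.mem_span_singleton_self q)
  refine (Submodule.finrank_mono hle).trans ?_
  simpa using finrank_span_le_card (R := ℂ) ({q} : Set (V m))

/-- For `m < 2` a monic polynomial is determined by a root; this replaces the conditions on extremal
roots, which are imposed only for `m ≥ 2`. -/
lemma eq_of_common_root (hm : m < 2) {P Q : ℝ[X]} (hP : P.natDegree ≤ m) (hQ : Q.natDegree ≤ m)
    (hPm : P.coeff m = 1) (hQm : Q.coeff m = 1) {x : ℝ} (hPx : P.IsRoot x) (hQx : Q.IsRoot x) :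
    P = Q := by
  rw [eq_X_add_C_of_natDegree_le_one (hP.trans (by omega : m ≤ 1))] at hPx ⊢
  rw [eq_X_add_C_of_natDegree_le_one (hQ.trans (by omega : m ≤ 1))] at hQx ⊢
  rw [IsRoot.def] at hPx hQx
  simp only [eval_add, eval_mul, eval_C, eval_X] at hPx hQx
  interval_cases m
  · rw [coeff_eq_zero_of_natDegree_lt (n := 1) (by omega), hPm] at hPx
    simp at hPx
  · rw [hPm] at hPx ⊢
    rw [hQm] at hQx ⊢
    rw [show P.coeff 0 = Q.coeff 0 by linarith]

/-- If all values at real forms are real combinations of two forms, then all values are complex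
combinations of them. -/
lemma exists_complex_combination {q₁ q₂ : V m}
    (h : ∀ p : VR n, ∃ r s : ℝ, T (p : V n) = r • q₁ + s • q₂) (p : V n) :
    ∃ r s : ℂ, T p = r • q₁ + s • q₂ := by
  have hp : p = hom n (toC (rePart (dehom n p))) +
      Complex.I • hom n (toC (imPart (dehom n p))) := by
    rw [← map_smul, ← map_add, smul_eq_C_mul, rePart_add_imPart, hom_dehom]
  obtain ⟨r₁, s₁, h₁⟩ := h ⟨_, hom_toC_mem_VR n (rePart (dehom n p))⟩
  obtain ⟨r₂, s₂, h₂⟩ := h ⟨_, hom_toC_mem_VR n (imPart (dehom n p))⟩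
  have hs : ∀ (r : ℝ) (q : V m), r • q = (r : ℂ) • q := fun r q => (algebraMap_smul ℂ r q).symm
  simp only [hs] at h₁ h₂
  refine ⟨r₁ + Complex.I * r₂, s₁ + Complex.I * s₂, ?_⟩
  conv_lhs => rw [hp, map_add, map_smul, h₁, h₂]
  module

/-- The degenerate condition implies the mapping properties. -/
theorem of_isDegenerate (hT : IsRealOperator T) (hJ : IsHalfOpen J a b)
    (h : IsDegenerate T I J) :
    (∀ P : ℝ[X], P.natDegree ≤ n → P.Splits → (realOp T P).Splits) ∧
      MapsRooted n m I J (realOp T) := by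
  obtain ⟨-, p₁, p₂, ψ₁, ψ₂, hr₁, hr₂, hm₁, hm₂, hpp, hTψ, hψ, hlow, htwo⟩ := h
  obtain ⟨P₁, hP₁⟩ := (mem_VR_iff _).1 hr₁
  obtain ⟨P₂, hP₂⟩ := (mem_VR_iff _).1 hr₂
  have hc₁ : P₁.coeff m = 1 := by
    rw [isTopMonic_iff, hP₁, coeff_map] at hm₁
    exact Complex.ofReal_eq_one.1 hm₁
  have hc₂ : P₂.coeff m = 1 := by
    rw [isTopMonic_iff, hP₂, coeff_map] at hm₂
    exact Complex.ofReal_eq_one.1 hm₂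
  have hd₁ : P₁.natDegree ≤ m := by
    have := natDegree_dehom_le p₁
    rwa [hP₁, natDegree_map] at this
  have hd₂ : P₂.natDegree ≤ m := by
    have := natDegree_dehom_le p₂
    rwa [hP₂, natDegree_map] at this
  have hP₂0 : P₂ ≠ 0 := by rintro rfl; simp at hc₂
  have hsplit := splits_combination_of_properPosition hP₁ hP₂ hP₂0 hpp
  have hA : ∀ p : VR n, realOp T (realPoly n p) = C (ψ₁ p) * P₁ + C (ψ₂ p) * P₂ := by
    intro p
    apply toC_injective
    rw [← dehom_apply_real hT, hTψ, map_add, dehom_real_smul, dehom_real_smul, hP₁, hP₂]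
    simp [toC]
  have hsurj : ∀ P : ℝ[X], P.natDegree ≤ n → ∃ p : VR n, realPoly n p = P := by
    intro P hP
    refine ⟨⟨hom n (toC P), hom_toC_mem_VR n P⟩, toC_injective ?_⟩
    rw [toC_realPoly]
    exact dehom_hom (natDegree_map_le.trans hP)
  refine ⟨fun P hP _ => ?_, fun P hP hroot => ?_⟩
  · obtain ⟨p, rfl⟩ := hsurj P hP
    rw [hA]
    exact hsplit _ _
  obtain ⟨p, rfl⟩ := hsurj P hP
  have hpI : IsRootedIn (realSet I) (p : V n) :=
    (isRootedIn_realSet_iff (toC_realPoly p).symm).2 hroot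
  obtain ⟨hsign, hne⟩ := hψ p hpI
  rw [hA]
  have hIcc : (∀ x, P₁.IsRoot x → x ∈ Set.Icc a b) ∧ (∀ x, P₂.IsRoot x → x ∈ Set.Icc a b) := by
    by_cases hdim : imageDim T = 2
    · obtain ⟨h1, h2, -⟩ := htwo hdim
      exact ⟨((rootedAt_closure_iff hJ).1 ((isRootedIn_realSet_iff hP₁).1 h1)).2.2,
        ((rootedAt_closure_iff hJ).1 ((isRootedIn_realSet_iff hP₂).1 h2)).2.2⟩
    · obtain ⟨h1, h2⟩ := hlow hdim
      exact ⟨fun x hx => hJ.subset_Icc (((isRootedIn_realSet_iff hP₁).1 h1).mem_of_isRoot x hx),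
        fun x hx => hJ.subset_Icc (((isRootedIn_realSet_iff hP₂).1 h2).mem_of_isRoot x hx)⟩
  have hs₁ : P₁.Splits := by simpa using hsplit 1 0
  have hs₂ : P₂.Splits := by simpa using hsplit 0 1
  -- A common root outside `J` is an endpoint. At `a` it would be the least root of `P₂`, at `b` the
  -- greatest root of `P₁`, and both of these lie in `J`. For `m < 2` it forces `P₁ = P₂` and image
  -- dimension at most one.
  have hcommon : ∀ x, x ∉ J → P₁.IsRoot x → ¬ P₂.IsRoot x := by
    intro x hx h1 h2
    by_cases hdim : imageDim T = 2
    · obtain ⟨-, -, hbig, -⟩ := htwo hdim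
      rcases le_or_gt 2 m with hm | hm
      · obtain ⟨⟨r, hrJ, hr⟩, ⟨s, hsJ, hs⟩⟩ := hbig hm
        rw [realRoots_eq hP₁] at hr
        rw [realRoots_eq hP₂] at hs
        rcases hJ.eq_or_eq hx (hIcc.1 x h1) with rfl | rfl
        · exact hx (le_antisymm (hs.2 h2) (hJ.subset_Icc hsJ).1 ▸ hsJ)
        · exact hx (le_antisymm (hr.2 h1) (hJ.subset_Icc hrJ).2 ▸ hrJ)
      · have heq : P₁ = P₂ := eq_of_common_root hm hd₁ hd₂ hc₁ hc₂ h1 h2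
        have hpeq : p₁ = p₂ := dehom_injective m (by rw [hP₁, hP₂, heq])
        have hle : imageDim T ≤ 1 := by
          refine imageDim_le_one (q := p₁) fun p => ?_
          obtain ⟨r, s, hrs⟩ := exists_complex_combination (q₁ := p₁) (q₂ := p₂)
            (fun p => ⟨_, _, hTψ p⟩) p
          exact ⟨r + s, by rw [hrs, ← hpeq, add_smul]⟩
        omega
    · exact hx (((isRootedIn_realSet_iff hP₁).1 (hlow hdim).1).mem_of_isRoot x h1)
  refine ⟨?_, hsplit _ _, fun x hx => ?_⟩
  · rw [coeff_add, coeff_C_mul, coeff_C_mul, hc₁, hc₂, mul_one, mul_one]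
    intro h0
    have h1 : ψ₁ p = -ψ₂ p := by linarith
    rw [h1] at hsign
    have h2 : ψ₂ p = 0 := by nlinarith
    rw [h1, h2] at hne
    simp at hne
  · by_contra hxJ
    have hmon₁ : P₁.Monic := monic_of_natDegree_le_of_coeff_eq_one m hd₁ hc₁
    have hmon₂ : P₂.Monic := monic_of_natDegree_le_of_coeff_eq_one m hd₂ hc₂
    have hnd₁ : P₁.natDegree = m := le_antisymm hd₁ (le_natDegree_of_ne_zero (by simp [hc₁]))
    have hnd₂ : P₂.natDegree = m := le_antisymm hd₂ (le_natDegree_of_ne_zero (by simp [hc₂]))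
    -- Outside `J` both monic polynomials have the same weak sign: `(-1) ^ m` on the left, `+` on
    -- the right.
    obtain ⟨e, he, h1, h2⟩ : ∃ e : ℝ, e ≠ 0 ∧ 0 ≤ e * P₁.eval x ∧ 0 ≤ e * P₂.eval x := by
      rcases hJ.le_or_ge hxJ with hle | hge
      · refine ⟨(-1) ^ m, pow_ne_zero _ (by norm_num), ?_, ?_⟩
        · have := pow_le_eval_left hs₁ hmon₁ (fun r hr => (hIcc.1 r hr).1) hle
          rw [hnd₁] at this
          exact (pow_nonneg (sub_nonneg.2 hle) m).trans this
        · have := pow_le_eval_left hs₂ hmon₂ (fun r hr => (hIcc.2 r hr).1) hle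
          rw [hnd₂] at this
          exact (pow_nonneg (sub_nonneg.2 hle) m).trans this
      · refine ⟨1, one_ne_zero, ?_, ?_⟩
        · rw [one_mul]
          exact (pow_nonneg (sub_nonneg.2 hge) _).trans
            (pow_le_eval hs₁ hmon₁ (fun r hr => (hIcc.1 r hr).2) hge)
        · rw [one_mul]
          exact (pow_nonneg (sub_nonneg.2 hge) _).trans
            (pow_le_eval hs₂ hmon₂ (fun r hr => (hIcc.2 r hr).2) hge)
    have hx0 : ψ₁ p * P₁.eval x + ψ₂ p * P₂.eval x = 0 := by
      simpa using hx
    have hcase : ∀ {q : V m} {P : ℝ[X]}, dehom m q = toC P → P.IsRoot x →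
        ¬ IsRootedIn (realSet J) q := fun hq hPx hrt =>
      hxJ (((isRootedIn_realSet_iff hq).1 hrt).mem_of_isRoot x hPx)
    by_cases hz₁ : ψ₁ p = 0
    · have hz₂ : ψ₂ p ≠ 0 := by simpa [hz₁] using hne
      have hr : P₂.IsRoot x := by simpa [hz₁, hz₂] using hx0
      by_cases hdim : imageDim T = 2
      · exact (htwo hdim).2.2.2.1 (hcase hP₂ hr) p hpI hz₁
      · exact hcase hP₂ hr (hlow hdim).2
    by_cases hz₂ : ψ₂ p = 0
    · have hr : P₁.IsRoot x := by simpa [hz₁, hz₂] using hx0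
      by_cases hdim : imageDim T = 2
      · exact (htwo hdim).2.2.2.2 (hcase hP₁ hr) p hpI hz₂
      · exact hcase hP₁ hr (hlow hdim).1
    have hpos : 0 < ψ₁ p * ψ₂ p := lt_of_le_of_ne hsign (mul_ne_zero hz₁ hz₂).symm
    -- Multiplication by `e ψ₁` makes both summands nonnegative, so `x` is a common root.
    have h3 : (ψ₁ p * ψ₁ p) * (e * P₁.eval x) + (ψ₁ p * ψ₂ p) * (e * P₂.eval x) = 0 := by
      linear_combination e * ψ₁ p * hx0
    have hsq : 0 < ψ₁ p * ψ₁ p := mul_self_pos.2 hz₁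
    have h4 : e * P₁.eval x = 0 := by nlinarith [mul_nonneg hsq.le h1, mul_nonneg hpos.le h2]
    have h5 : e * P₂.eval x = 0 := by nlinarith [mul_nonneg hsq.le h1, mul_nonneg hpos.le h2]
    exact hcommon x hxJ ((mul_eq_zero.1 h4).resolve_left he) ((mul_eq_zero.1 h5).resolve_left he)

end

/-! ### Operators with only real-rooted values are degenerate. -/

section


variable {n m : ℕ} {T : V n →ₗ[ℂ] V m} {I J : Set ℝ} {a b : ℝ}

/-- The pairing with a fixed polynomial at a fixed point, as a linear functional. -/
noncomputable def pairingLeft (u : ℝ[X]) (z : ℂ) : ℝ[X] →ₗ[ℝ] ℝ where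
  toFun P := imPairing P u z
  map_add' P Q := by simp [imPairing, toC, add_mul]
  map_smul' r P := by
    simp only [imPairing, toC, Polynomial.map_smul, eval_smul, RingHom.id_apply, smul_eq_mul,
      mul_assoc]
    exact Complex.im_ofReal_mul _ _

lemma dehom_hom_real {P : ℝ[X]} (hP : P.natDegree ≤ m) : dehom m (hom m (toC P)) = toC P :=
  dehom_hom (natDegree_map_le.trans hP)

lemma dehom_add_I_smul {q₁ q₂ : V m} {P₁ P₂ : ℝ[X]} (h₁ : dehom m q₁ = toC P₁)
    (h₂ : dehom m q₂ = toC P₂) :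
    dehom m (q₂ + Complex.I • q₁) = toC P₂ + C Complex.I * toC P₁ := by
  rw [map_add, map_smul, h₁, h₂, smul_eq_C_mul]

lemma properPosition_of_pairing {q₁ q₂ : V m} {P₁ P₂ : ℝ[X]} (h₁ : dehom m q₁ = toC P₁)
    (h₂ : dehom m q₂ = toC P₂) (h : ∀ z : ℂ, 0 < z.im → 0 < imPairing P₂ P₁ z) :
    ProperPosition q₁ q₂ := by
  right
  rintro _ ⟨z, hz, rfl⟩ h0
  rw [isRoot_iff, dehom_add_I_smul h₁ h₂, evalAt_coe] at h0
  have h1 := imPairing_eq P₂ P₁ z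
  rw [h0, Complex.normSq_zero] at h1
  linarith [h z hz, Complex.normSq_nonneg ((toC P₂ + C Complex.I * toC P₁).eval (conj z))]

lemma properPosition_self {q : V m} {P : ℝ[X]} (h : dehom m q = toC P) (hP : P.Splits)
    (h0 : P ≠ 0) : ProperPosition q q := by
  right
  rintro _ ⟨z, hz, rfl⟩ h1
  rw [isRoot_iff, dehom_add_I_smul h h, evalAt_coe, eval_add, eval_mul, eval_C] at h1
  have h2 : (1 + Complex.I) * (toC P).eval z = 0 := by linear_combination h1
  rcases mul_eq_zero.1 h2 with h3 | h3
  · have := congrArg Complex.re h3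
    simp at this
  · exact eval_toC_ne_zero hP h0 (ne_of_gt hz) h3

/-- An operator with real-rooted values whose image is a line. -/
lemma isDegenerate_of_line (hT : IsRealOperator T) (hR : MapsRooted n m I J (realOp T))
    {u : ℝ[X]} (hu : RootedAt m J u) (hum : u.coeff m = 1) (hud : u.natDegree ≤ m)
    (hline : ∀ P : ℝ[X], P.natDegree ≤ n → realOp T P = C ((realOp T P).coeff m) * u) :
    IsDegenerate T I J := by
  set q : V m := hom m (toC u) with hq
  have hqd : dehom m q = toC u := dehom_hom_real hud
  set ψ : VR n →ₗ[ℝ] ℝ := lcoeff ℝ m ∘ₗ realOp T ∘ₗ realPoly n with hψ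
  have hψa : ∀ p, ψ p = (realOp T (realPoly n p)).coeff m := fun p => rfl
  have hTq : ∀ p : VR n, T (p : V n) = ψ p • q + (0 : VR n →ₗ[ℝ] ℝ) p • q := by
    intro p
    apply dehom_injective m
    rw [LinearMap.zero_apply, zero_smul, add_zero, dehom_apply_real hT,
      hline _ (natDegree_realPoly_le p), dehom_real_smul, hqd, hψa]
    simp [toC]
  have hdim : imageDim T ≤ 1 := imageDim_le_one (q := q) fun p => by
    obtain ⟨r, s, hrs⟩ := exists_complex_combination (fun p => ⟨_, _, hTq p⟩) p
    exact ⟨r + s, by rw [hrs, add_smul]⟩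
  have hu0 : u ≠ 0 := by rintro rfl; simp at hum
  have htop : IsTopMonic q := by
    rw [isTopMonic_iff, hqd, coeff_map, hum]
    simp
  have hrt : IsRootedIn (realSet J) q := (isRootedIn_realSet_iff hqd).2 hu
  refine ⟨hdim.trans one_le_two, q, q, ψ, 0, hom_toC_mem_VR _ _, hom_toC_mem_VR _ _, htop, htop,
    properPosition_self hqd hu.splits hu0, hTq, fun p hp => ⟨by simp, Or.inl ?_⟩,
    fun _ => ⟨hrt, hrt⟩, fun h2 => by omega⟩
  exact (hR _ (natDegree_realPoly_le p)
    ((isRootedIn_realSet_iff (toC_realPoly p).symm).1 hp)).coeff_ne_zero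

/-- Every real-rooted plane of polynomials with a monic element of degree `m` is spanned by this
element and a polynomial of smaller degree. -/
lemma combination_of_splits {u v w : ℝ[X]} (hum : u.coeff m = 1) (hvm : v.coeff m = 0)
    (hvu : imPairing v u Complex.I ≠ 0)
    (hsp : ∀ α β : ℝ, (w - C α * v - C β * u).Splits) :
    w = C (w.coeff m) * u + C (imPairing w u Complex.I / imPairing v u Complex.I) * v := by
  obtain ⟨D, hD⟩ : ∃ D, imPairing v u Complex.I = D := ⟨_, rfl⟩
  rw [hD] at hvu ⊢
  -- Cramer's rule: `α`, `β` make `w - α v - β u` vanish at `i`, which a nonzero real-rooted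
  -- polynomial cannot do.
  set α := imPairing w u Complex.I / D with hα
  set β := imPairing v w Complex.I / D with hβ
  have h1 : w - C α * v - C β * u = 0 := by
    by_contra hne
    refine eval_toC_ne_zero (hsp α β) hne (z := Complex.I) (by simp) ?_
    have hα' : α * D = imPairing w u Complex.I := div_mul_cancel₀ _ hvu
    have hβ' : β * D = imPairing v w Complex.I := div_mul_cancel₀ _ hvu
    simp only [toC, Polynomial.map_sub, Polynomial.map_mul, map_C, eval_sub, eval_mul, eval_C]
    simp only [imPairing, toC, Complex.mul_im, Complex.conj_re, Complex.conj_im] at hα' hβ' hD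
    set W := eval Complex.I (Polynomial.map (algebraMap ℝ ℂ) w)
    set U := eval Complex.I (Polynomial.map (algebraMap ℝ ℂ) u)
    set Y := eval Complex.I (Polynomial.map (algebraMap ℝ ℂ) v)
    apply Complex.ext
    · simp
      refine mul_left_cancel₀ hvu ?_
      rw [mul_zero]
      linear_combination (-Y.re) * hα' - U.re * hβ' - W.re * hD
    · simp
      refine mul_left_cancel₀ hvu ?_
      rw [mul_zero]
      linear_combination (-Y.im) * hα' - U.im * hβ' - W.im * hD
  have h2 : w = C α * v + C β * u := by linear_combination h1
  have h3 : w.coeff m = β := by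
    conv_lhs => rw [h2]
    rw [coeff_add, coeff_C_mul, coeff_C_mul, hum, hvm]
    ring
  rw [h3, add_comm]
  exact h2

lemma imageDim_eq_two {q₁ q₂ : V m} (h₁ : ∃ p, T p = q₁) (h₂ : ∃ p, T p = q₂)
    (h : ∀ p : V n, ∃ r s : ℂ, T p = r • q₁ + s • q₂)
    (hind : ∀ r s : ℂ, r • q₁ + s • q₂ = 0 → r = 0 ∧ s = 0) : imageDim T = 2 := by
  have hr : LinearMap.range T = Submodule.span ℂ (Set.range ![q₁, q₂]) := by
    rw [Matrix.range_cons, Matrix.range_cons, Matrix.range_empty, Set.union_empty,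
      Set.singleton_union]
    ext q
    rw [Submodule.mem_span_pair]
    constructor
    · rintro ⟨p, rfl⟩
      obtain ⟨r, s, hrs⟩ := h p
      exact ⟨r, s, hrs.symm⟩
    · rintro ⟨r, s, rfl⟩
      obtain ⟨x, rfl⟩ := h₁
      obtain ⟨y, rfl⟩ := h₂
      exact ⟨r • x + s • y, by simp⟩
  rw [imageDim, hr, finrank_span_eq_card (LinearIndependent.pair_iff.2 hind), Fintype.card_fin]

/-- An operator with real-rooted values whose image is a plane. -/
lemma isDegenerate_of_pencil (hT : IsRealOperator T) (hR : MapsRooted n m I J (realOp T))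
    (hJ : IsHalfOpen J a b) {u v : ℝ[X]} (huv : IsPencil m u v)
    (h0 : 0 ∈ IsPencil.params u v J)
    (hu : ∃ P : ℝ[X], realOp T P = u) (hv : ∃ P : ℝ[X], realOp T P = v)
    (hplane : ∀ P : ℝ[X], P.natDegree ≤ n → realOp T P = C ((realOp T P).coeff m) * u +
      C (imPairing (realOp T P) u Complex.I / imPairing v u Complex.I) * v) :
    IsDegenerate T I J := by
  have hAB := isComplexification hT
  set D := imPairing v u Complex.I with hD
  have hD0 : 0 < D := huv.pairing_pos _ (by simp)
  obtain ⟨t₁, t₂, hlt, ht₁, ht₂, hmem, hc₁, hc₂⟩ := huv.exists_endpoints hJ h0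
  set P : ℝ → ℝ[X] := fun t => u + C t * v with hP
  set q : ℝ → V m := fun t => hom m (toC (P t)) with hq
  have hqd : ∀ t, dehom m (q t) = toC (P t) := fun t => dehom_hom_real (huv.natDegree_add t).le
  set ℓ : VR n →ₗ[ℝ] ℝ := lcoeff ℝ m ∘ₗ realOp T ∘ₗ realPoly n with hℓ
  have hℓa : ∀ p, ℓ p = (realOp T (realPoly n p)).coeff m := fun p => rfl
  set κ : VR n →ₗ[ℝ] ℝ := D⁻¹ • (pairingLeft u Complex.I ∘ₗ realOp T ∘ₗ realPoly n) with hκ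
  have hκa : ∀ p, κ p = imPairing (realOp T (realPoly n p)) u Complex.I / D := fun p => by
    rw [div_eq_inv_mul]; rfl
  have hA : ∀ p : VR n, realOp T (realPoly n p) = C (ℓ p) * u + C (κ p) * v := fun p => by
    rw [hℓa, hκa]
    exact hplane _ (natDegree_realPoly_le p)
  have hd0 : 0 < t₂ - t₁ := sub_pos.2 hlt
  -- The solution of `ψ₁ + ψ₂ = ℓ`, `t₁ ψ₁ + t₂ ψ₂ = κ`, which rewrites `ℓ u + κ v` in the basis `u
  -- + t₁ v`, `u + t₂ v`.
  set ψ₁ : VR n →ₗ[ℝ] ℝ := (t₂ - t₁)⁻¹ • (t₂ • ℓ - κ) with hψ₁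
  set ψ₂ : VR n →ₗ[ℝ] ℝ := (t₂ - t₁)⁻¹ • (κ - t₁ • ℓ) with hψ₂
  have hψ₁a : ∀ p, ψ₁ p = (t₂ - t₁)⁻¹ * (t₂ * ℓ p - κ p) := fun p => rfl
  have hψ₂a : ∀ p, ψ₂ p = (t₂ - t₁)⁻¹ * (κ p - t₁ * ℓ p) := fun p => rfl
  have hTq : ∀ p : VR n, T (p : V n) = ψ₁ p • q t₁ + ψ₂ p • q t₂ := by
    intro p
    apply dehom_injective m
    rw [dehom_apply_real hT, map_add, dehom_real_smul, dehom_real_smul, hqd, hqd, hA]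
    have h1 : C (ℓ p) * u + C (κ p) * v = C (ψ₁ p) * P t₁ + C (ψ₂ p) * P t₂ := by
      have e1 : ψ₁ p + ψ₂ p = ℓ p := by rw [hψ₁a, hψ₂a]; field_simp; ring
      have e2 : ψ₁ p * t₁ + ψ₂ p * t₂ = κ p := by rw [hψ₁a, hψ₂a]; field_simp; ring
      rw [← e1, ← e2, hP]
      simp only [C_add, C_mul]
      ring
    rw [h1]
    simp [toC]
  have hdim : imageDim T = 2 := by
    obtain ⟨Pu, hPu⟩ := hu
    obtain ⟨Pv, hPv⟩ := hv
    have hdeg : v.natDegree ≤ m := by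
      rw [← huv.natDegree]; exact natDegree_le_natDegree huv.degree_lt.le
    have hud : dehom m (hom m (toC u)) = toC u := dehom_hom_real huv.natDegree.le
    have hvd : dehom m (hom m (toC v)) = toC v := dehom_hom_real hdeg
    refine imageDim_eq_two (q₁ := hom m (toC u)) (q₂ := hom m (toC v))
      ⟨hom n (toC Pu), dehom_injective m ?_⟩ ⟨hom n (toC Pv), dehom_injective m ?_⟩ ?_ ?_
    · rw [hud, ← hPu]; exact hAB.map_toC Pu
    · rw [hvd, ← hPv]; exact hAB.map_toC Pv
    · refine exists_complex_combination fun p => ⟨ℓ p, κ p, dehom_injective m ?_⟩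
      rw [dehom_apply_real hT, hA, map_add, dehom_real_smul, dehom_real_smul, hud, hvd]
      simp [toC]
    · intro r s hrs
      have h1 := congrArg (dehom m) hrs
      rw [map_add, map_smul, map_smul, hud, hvd, map_zero] at h1
      have h2 := congrArg (fun Q => coeff Q m) h1
      have hum : u.coeff m = 1 := by
        have := huv.monic.coeff_natDegree
        rwa [huv.natDegree] at this
      have hvm : v.coeff m = 0 := by
        refine coeff_eq_zero_of_degree_lt (huv.degree_lt.trans_eq ?_)
        rw [degree_eq_natDegree huv.monic.ne_zero, huv.natDegree]
      simp only [coeff_add, coeff_smul, coeff_map, hum, hvm, coeff_zero, map_one, map_zero,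
        smul_eq_mul, mul_one, mul_zero, add_zero] at h2
      refine ⟨h2, ?_⟩
      rw [h2, zero_smul, zero_add, smul_eq_zero] at h1
      refine h1.resolve_right fun h3 => ?_
      rw [(Polynomial.map_eq_zero _).1 h3] at hD
      rw [hD] at hD0
      simp [imPairing] at hD0
  have hcoeffP : ∀ t, (P t).coeff m = 1 := fun t => by
    have := (huv.monic_add t).coeff_natDegree
    rwa [huv.natDegree_add] at this
  have htop : ∀ t, IsTopMonic (q t) := fun t => by
    rw [isTopMonic_iff, hqd, coeff_map, hcoeffP]
    simp
  have hcl : ∀ t ∈ closure (IsPencil.params u v J), IsRootedIn (realSet (closure J)) (q t) :=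
    fun t ht => (isRootedIn_realSet_iff (hqd t)).2 ((rootedAt_closure_iff hJ).2
      ⟨by rw [hcoeffP]; exact one_ne_zero, huv.splits t,
        fun x hx => huv.mem_Icc_of_mem_closure hJ ht hx⟩)
  have hprop : ProperPosition (q t₁) (q t₂) := by
    refine properPosition_of_pairing (hqd t₁) (hqd t₂) fun z hz => ?_
    -- The pairing of `u + t₂ v` with `u + t₁ v` is `t₂ - t₁` times that of `v` with `u`.
    have h1 := mul_pos hd0 (huv.pairing_pos z hz)
    refine h1.trans_eq ?_
    simp only [hP, imPairing, toC, Polynomial.map_add, Polynomial.map_mul, map_C, eval_add,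
      eval_mul, eval_C, Complex.coe_algebraMap, map_add, map_mul, Complex.conj_ofReal,
      Complex.mul_im, Complex.add_re, Complex.add_im, Complex.mul_re, Complex.ofReal_re,
      Complex.ofReal_im, Complex.conj_re, Complex.conj_im]
    ring
  -- The image of an `I`-rooted form, divided by its top coefficient, is the pencil member with
  -- parameter `κ / ℓ`; this parameter therefore lies between `t₁` and `t₂`.
  have hparam : ∀ p : VR n, IsRootedIn (realSet I) (p : V n) →
      ℓ p ≠ 0 ∧ κ p / ℓ p ∈ IsPencil.params u v J := by
    intro p hp
    have h1 := hR _ (natDegree_realPoly_le p) ((isRootedIn_realSet_iff (toC_realPoly p).symm).1 hp)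
    have h2 : ℓ p ≠ 0 := h1.coeff_ne_zero
    refine ⟨h2, fun x hx => h1.mem_of_isRoot x ?_⟩
    rw [hA]
    have h3 : C (ℓ p) * u + C (κ p) * v = C (ℓ p) * (u + C (κ p / ℓ p) * v) := by
      rw [mul_add, ← mul_assoc, ← C_mul, mul_div_cancel₀ _ h2]
    rw [h3, IsRoot.def, eval_mul, hx.eq_zero, mul_zero]
  have hnotJ : ∀ t, ¬ IsRootedIn (realSet J) (q t) → t ∉ IsPencil.params u v J := by
    intro t hnt ht
    exact hnt ((isRootedIn_realSet_iff (hqd t)).2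
      ⟨by rw [hcoeffP]; exact one_ne_zero, huv.splits t, ht⟩)
  refine ⟨hdim.le, q t₁, q t₂, ψ₁, ψ₂, hom_toC_mem_VR _ _, hom_toC_mem_VR _ _, htop _, htop _,
    hprop, hTq, fun p hp => ?_, fun hne => absurd hdim hne, fun _ => ⟨hcl _ hc₁, hcl _ hc₂,
      fun hm => ?_, fun hn p hp hz => ?_, fun hn p hp hz => ?_⟩⟩
  · obtain ⟨hl0, ht⟩ := hparam p hp
    obtain ⟨h1, h2⟩ := hmem _ ht
    constructor
    · have h3 : ψ₁ p * ψ₂ p =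
          (t₂ - t₁)⁻¹ ^ 2 * ℓ p ^ 2 * ((t₂ - κ p / ℓ p) * (κ p / ℓ p - t₁)) := by
        rw [hψ₁a, hψ₂a]
        field_simp
      rw [h3]
      exact mul_nonneg (by positivity) (mul_nonneg (sub_nonneg.2 h2) (sub_nonneg.2 h1))
    · by_contra! hcon
      have e1 : ψ₁ p + ψ₂ p = ℓ p := by rw [hψ₁a, hψ₂a]; field_simp; ring
      rw [hcon.1, hcon.2, add_zero] at e1
      exact hl0 e1.symm
  · rw [realRoots_eq (hqd t₁), realRoots_eq (hqd t₂)]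
    exact ⟨huv.exists_isGreatest_mem hJ h0 hm hc₁ ht₁, huv.exists_isLeast_mem hJ h0 hm hc₂ ht₂⟩
  -- If `ψ₁ p = 0`, the parameter is `t₂` itself, so the member at `t₂` is `J`-rooted after all; the
  -- last case is the same with `t₁`.
  · obtain ⟨hl0, ht⟩ := hparam p hp
    rw [hψ₁a, mul_eq_zero, or_iff_right (inv_ne_zero hd0.ne')] at hz
    refine hnotJ t₂ hn ?_
    rwa [show κ p / ℓ p = t₂ by rw [div_eq_iff hl0]; linarith] at ht
  · obtain ⟨hl0, ht⟩ := hparam p hp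
    rw [hψ₂a, mul_eq_zero, or_iff_right (inv_ne_zero hd0.ne')] at hz
    refine hnotJ t₁ hn ?_
    rwa [show κ p / ℓ p = t₁ by rw [div_eq_iff hl0]; linarith] at ht

/-- An operator all of whose real values are real-rooted is degenerate. -/
theorem isDegenerate_of_splits (hT : IsRealOperator T) (hI' : I.Nonempty) (hJ : IsHalfOpen J a b)
    (hR : MapsRooted n m I J (realOp T))
    (hA : ∀ P : ℝ[X], P.natDegree ≤ n → (realOp T P).Splits) : IsDegenerate T I J := by
  have hAB := isComplexification hT
  obtain ⟨t, ht⟩ := hI'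
  set P₀ : ℝ[X] := (C t - X) ^ n with hP₀
  have hP₀d : P₀.natDegree ≤ n := natDegree_C_sub_X_pow_le t
  have hroot := hR P₀ hP₀d (rootedAt_pow ht)
  set c := (realOp T P₀).coeff m with hc
  have hc0 : c ≠ 0 := hroot.coeff_ne_zero
  set u : ℝ[X] := realOp T (c⁻¹ • P₀) with hu
  have hu' : u = C c⁻¹ * realOp T P₀ := by rw [hu, map_smul, smul_eq_C_mul]
  have hum : u.coeff m = 1 := by rw [hu', coeff_C_mul, inv_mul_cancel₀ hc0]
  have hud : u.natDegree ≤ m := hAB.natDegree_le _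
  have huroot : RootedAt m J u := by
    refine ⟨by rw [hum]; exact one_ne_zero, by rw [hu']; exact hroot.splits.C_mul _, fun x hx => ?_⟩
    rw [hu', IsRoot.def, eval_mul, eval_C, mul_eq_zero, or_iff_right (inv_ne_zero hc0)] at hx
    exact hroot.mem_of_isRoot x hx
  by_cases hline : ∀ P : ℝ[X], P.natDegree ≤ n → realOp T P = C ((realOp T P).coeff m) * u
  · exact isDegenerate_of_line hT hR huroot hum hud hline
  push Not at hline
  obtain ⟨P₁, hP₁d, hP₁⟩ := hline
  -- Subtracting a multiple of `u` from a value off the line spanned by `u` removes the top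
  -- coefficient.
  obtain ⟨Pv, hPvd, hPv0, hPvm⟩ : ∃ Pv : ℝ[X], Pv.natDegree ≤ n ∧ realOp T Pv ≠ 0 ∧
      (realOp T Pv).coeff m = 0 := by
    have hval : realOp T (P₁ - (realOp T P₁).coeff m • (c⁻¹ • P₀)) =
        realOp T P₁ - C ((realOp T P₁).coeff m) * u := by
      rw [map_sub, map_smul, ← hu, smul_eq_C_mul]
    refine ⟨P₁ - (realOp T P₁).coeff m • (c⁻¹ • P₀), ?_, ?_, ?_⟩
    · exact (natDegree_sub_le _ _).trans (max_le hP₁d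
        ((natDegree_smul_le _ _).trans ((natDegree_smul_le _ _).trans hP₀d)))
    · rw [hval]; exact sub_ne_zero.2 hP₁
    · rw [hval, coeff_sub, coeff_C_mul, hum, mul_one, sub_self]
  have hcombo : ∀ P : ℝ[X], P.natDegree ≤ n → ∀ α β : ℝ,
      (C α * realOp T P + C β * u).Splits := by
    intro P hP α β
    have h1 : C α * realOp T P + C β * u = realOp T (α • P + β • (c⁻¹ • P₀)) := by
      rw [map_add, map_smul, map_smul, ← hu, smul_eq_C_mul, smul_eq_C_mul]
    rw [h1]
    exact hA _ (natDegree_add_le_of_degree_le ((natDegree_smul_le _ _).trans hP)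
      ((natDegree_smul_le _ _).trans ((natDegree_smul_le _ _).trans hP₀d)))
  -- A zero pairing would make the two values dependent, which the top coefficients `0` and `1`
  -- exclude.
  have hne : imPairing (realOp T Pv) u Complex.I ≠ 0 := by
    intro h0
    obtain ⟨α, β, hαβ, h1⟩ := exists_combination_eq_zero (hcombo Pv hPvd) (by simp) h0
    have h2 := congrArg (fun Q => coeff Q m) h1
    simp only [coeff_add, coeff_C_mul, hPvm, hum, mul_zero, zero_add, mul_one, coeff_zero] at h2
    rw [h2, C_0, zero_mul, add_zero, mul_eq_zero, or_iff_left hPv0, C_eq_zero] at h1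
    rcases hαβ with h | h
    · exact h h1
    · exact h h2
  -- The sign is chosen so that the roots of the pencil move to the right.
  obtain ⟨Q, hQd, hQm, hQpos⟩ : ∃ Q : ℝ[X], Q.natDegree ≤ n ∧ (realOp T Q).coeff m = 0 ∧
      0 < imPairing (realOp T Q) u Complex.I := by
    rcases hne.lt_or_gt with h | h
    · refine ⟨-Pv, by rwa [natDegree_neg], by rw [map_neg, coeff_neg, hPvm, neg_zero], ?_⟩
      have h1 := map_neg (pairingLeft u Complex.I) (realOp T Pv)
      rw [map_neg]
      exact (neg_pos.2 h).trans_eq h1.symm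
    · exact ⟨Pv, hPvd, hPvm, h⟩
  have hunat : u.natDegree = m := le_antisymm hud (le_natDegree_of_ne_zero (by simp [hum]))
  have humon : u.Monic := monic_of_natDegree_le_of_coeff_eq_one m hud hum
  have hpencil : IsPencil m u (realOp T Q) := by
    refine ⟨humon, hunat, ?_, fun s => ?_, fun z hz =>
      imPairing_pos (hcombo Q hQd) (by simp) hQpos hz⟩
    · rw [degree_eq_natDegree humon.ne_zero, hunat]
      refine (degree_lt_iff_coeff_zero _ _).2 fun k hk => ?_
      rcases hk.eq_or_lt with rfl | hk
      · exact hQm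
      · exact coeff_eq_zero_of_natDegree_lt ((hAB.natDegree_le Q).trans_lt hk)
    · have := hcombo Q hQd s 1
      rwa [C_1, one_mul, add_comm] at this
  refine isDegenerate_of_pencil hT hR hJ hpencil (fun x hx => huroot.mem_of_isRoot x ?_)
    ⟨_, rfl⟩ ⟨Q, rfl⟩ fun P hP => ?_
  · simpa using hx
  · refine combination_of_splits hum hQm hQpos.ne' fun α β => ?_
    have h1 : realOp T P - C α * realOp T Q - C β * u =
        C 1 * realOp T (P - α • Q) + C (-β) * u := by
      rw [map_sub, map_smul, smul_eq_C_mul, C_1, C_neg]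
      ring
    rw [h1]
    exact hcombo _ ((natDegree_sub_le _ _).trans
      (max_le hP ((natDegree_smul_le _ _).trans hQd))) _ _

end

end BinaryForm

/-! ### The equivalence. -/

theorem mainTheorem9 (n m : ℕ) (T : BinaryForm.V n →ₗ[ℂ] BinaryForm.V m)
    (hT : BinaryForm.IsRealOperator T)
    (I : Set ℝ) (hI : I.OrdConnected) (hI' : I.Nonempty)
    (J : Set ℝ) (a b : ℝ) (hab : a < b)
    (hJ : J = Set.Ioo a b ∨ J = Set.Ico a b ∨ J = Set.Ioc a b) :
    (BinaryForm.PreservesWeakRealRootedness T ∧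
      ∀ p : BinaryForm.V n, BinaryForm.IsRootedIn (BinaryForm.realSet I) p →
        T p ≠ 0 ∧ BinaryForm.IsRootedIn (BinaryForm.realSet J) (T p)) ↔
    (BinaryForm.IsStableOn (BinaryForm.lowerH ∪ BinaryForm.realSet I)
        (closure BinaryForm.upperH \ BinaryForm.realSet J) (BinaryForm.symb T) ∨
      BinaryForm.IsStableOn (BinaryForm.lowerH ∪ BinaryForm.realSet I)
        (closure BinaryForm.lowerH \ BinaryForm.realSet J) (BinaryForm.symb T) ∨
      BinaryForm.IsDegenerate T I J) := by
  have hAB := BinaryForm.isComplexification hT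
  have hJ' := BinaryForm.isHalfOpen_of_eq hab hJ
  rw [BinaryForm.preservesWeakRealRootedness_iff hT, BinaryForm.mapsRooted_iff hT,
    BinaryForm.isStableOn_symb_iff, BinaryForm.isStableOn_symb_iff]
  constructor
  · rintro ⟨hW, hR⟩
    rcases BinaryForm.stable_or_stable_or_splits hAB hW with h | h | h
    · refine Or.inl fun z hz Q hQ => ?_
      refine BinaryForm.stable_of_stable_halfPlane hAB hI' hR (σ := 1) one_ne_zero
        (fun z hz x hx => h z hz x (by simpa using hx)) hQ.2 (fun w hw => ?_) hz
      rw [one_mul]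
      exact BinaryForm.coe_mem_closure_upperH.1 (hw ▸ hQ.1)
    · refine Or.inr (Or.inl fun z hz Q hQ => ?_)
      refine BinaryForm.stable_of_stable_halfPlane hAB hI' hR (σ := -1) (by norm_num)
        (fun z hz x hx => h z hz x (by simpa using hx)) hQ.2 (fun w hw => ?_) hz
      have := BinaryForm.coe_mem_closure_lowerH.1 (hw ▸ hQ.1)
      linarith
    · exact Or.inr (Or.inr (BinaryForm.isDegenerate_of_splits hT hI' hJ' hR h))
  · rintro (h | h | h)
    · refine ⟨fun P hdeg hP => BinaryForm.splits_apply_of_stable hAB hI hI'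
        (U := {x : ℂ | 0 < x.im}) (isOpen_lt continuous_const Complex.continuous_im)
        (fun z hz => ?_) (fun z hz x hx => h z hz x ⟨?_, fun hx' => ?_⟩) hdeg hP,
        BinaryForm.mapsRooted_of_stable hAB hI hI' BinaryForm.infty_mem_closure_upperH
          (fun w => ?_) h⟩
      · rcases hz.lt_or_gt with h0 | h0
        · exact Or.inr (by simpa using h0)
        · exact Or.inl h0
      · exact BinaryForm.coe_mem_closure_upperH.2 (le_of_lt hx)
      · exact (ne_of_gt hx) (BinaryForm.coe_mem_realSet.1 hx').1
      · rw [BinaryForm.coe_mem_closure_upperH, BinaryForm.coe_mem_closure_upperH]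
        simpa using le_total 0 w.im
    · refine ⟨fun P hdeg hP => BinaryForm.splits_apply_of_stable hAB hI hI'
        (U := {x : ℂ | x.im < 0}) (isOpen_lt Complex.continuous_im continuous_const)
        (fun z hz => ?_) (fun z hz x hx => h z hz x ⟨?_, fun hx' => ?_⟩) hdeg hP,
        BinaryForm.mapsRooted_of_stable hAB hI hI' BinaryForm.infty_mem_closure_lowerH
          (fun w => ?_) h⟩
      · rcases hz.lt_or_gt with h0 | h0
        · exact Or.inl h0
        · exact Or.inr (by simpa using h0)
      · exact BinaryForm.coe_mem_closure_lowerH.2 (le_of_lt hx)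
      · exact (ne_of_lt hx) (BinaryForm.coe_mem_realSet.1 hx').1
      · rw [BinaryForm.coe_mem_closure_lowerH, BinaryForm.coe_mem_closure_lowerH]
        simpa using le_total w.im 0
    · exact BinaryForm.of_isDegenerate hT hJ' h
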